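/- Let $\mathbb{F}$ be a field (for instance $\mathbb{F}=\mathbb{Q}$), let $n,k,r$ be nonnegative integers with $r\le n$, and let $\mathbf{x}_n=(x_1,\dots,x_n)$. Let $h_d$ and $e_d$ denote the complete homogeneous and elementary symmetric polynomials, let $$I_{n,k,r}=\langle h_{k+1}(\mathbf{x}_n),\dots,h_{k+n}(\mathbf{x}_n),\,e_n(\mathbf{x}_n),e_{n-1}(\mathbf{x}_n),\dots,e_{n-r+1}(\mathbf{x}_n)\rangle\subseteq\mathbb{F}[\mathbf{x}_n],\qquad R_{n,k,r}=\mathbb{F}[\mathbf{x}_n]/I_{n,k,r}.$$ For $S=\{s_1<\dots<s_m\}\subseteq[n]$ put $\mathbf{x}(S)=x_{s_1}^{s_1}x_{s_2}^{s_2-1}\cdots x_{s_m}^{s_m-m+1}$. Let $\mathcal{M}_{n,k,r}$ be the set of $(n,k,r)$-good monomials: the monomials $m$ in $x_1,\dots,x_n$ such that $\mathbf{x}(S)\nmid m$ for all $S\subseteq[n]$ with $|S|=n-r+1$, and $x_i^{k+i}\nmid m$ for all $1\le i\le n$. For a permutation $\pi\in S_N$ let $\mathfrak{S}_\pi$ be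 its Schubert polynomial: $\mathfrak{S}_{\pi}=x_1^{N-1}x_2^{N-2}\cdots x_{N-1}$ if $\pi=N(N-1)\cdots 1$, and $\mathfrak{S}_\pi=\partial_i\mathfrak{S}_{\pi s_i}$ whenever $\pi_i<\pi_{i+1}$, where $\pi s_i$ is $\pi$ with the entries in positions $i,i+1$ exchanged and $\partial_i f=(f-s_i f)/(x_i-x_{i+1})$, with $s_i$ exchanging $x_i$ and $x_{i+1}$ in $f$. Let $\Pi_{n,k,r}$ be the set of permutations $\pi$ of $\{1,\dots,n+k\}$ all of whose descents are at positions $\le n$ and such that $1,2,\dots,r$ all appear among $\pi_1,\dots,\pi_n$. For $\pi\in\Pi_{n,k,r}$ only $x_1,\dots,x_n$ occur in $\mathfrak{S}_\pi$; let $\mathfrak{S}_\pi(\mathbf{x}_n^*)=\mathfrak{S}_\pi(x_n,x_{n-1},\dots,x_1)$. Let $<$ be the lexicographic monomial order with $x_1>x_2>\dots>x_n$ and let $\mathrm{in}_<(f)$ be the leading term (with its coefficient) of $f$. Then $$\{\mathrm{in}_<(\mathfrak{S}_\pi(\mathbf{x}_n^*)):\pi\in\Pi_{n,k,r}\}=\mathcal{M}_{n,k,r},$$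 and the family of images of $\mathfrak{S}_\pi(\mathbf{x}_n^*)$, $\pi\in\Pi_{n,k,r}$, is an $\mathbb{F}$-basis of $R_{n,k,r}$. -/

import Mathlib

/-- The exchange of two variables in a polynomial. -/
noncomputable def swapVars {σ R : Type*} [CommRing R] [DecidableEq σ] (i j : σ) :
    MvPolynomial σ R →ₐ[R] MvPolynomial σ R :=
  MvPolynomial.rename (Equiv.swap i j)

theorem X_sub_X_dvd_sub_swapVars {σ R : Type*} [CommRing R] [DecidableEq σ] (i j : σ)
    (f : MvPolynomial σ R) :
    (MvPolynomial.X i - MvPolynomial.X j : MvPolynomial σ R) ∣ f - swapVars i j f := by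
  induction f using MvPolynomial.induction_on with
  | C a => simp [swapVars]
  | add p q hp hq =>
    have h : p + q - swapVars i j (p + q) = (p - swapVars i j p) + (q - swapVars i j q) := by
      rw [map_add]; ring
    rw [h]
    exact dvd_add hp hq
  | mul_X p s hp =>
    have h : p * MvPolynomial.X s - swapVars i j (p * MvPolynomial.X s) =
        (p - swapVars i j p) * MvPolynomial.X s +
          swapVars i j p * (MvPolynomial.X s - swapVars i j (MvPolynomial.X s)) := by
      rw [map_mul]; ring
    rw [h]
    refine dvd_add (Dvd.dvd.mul_right hp _) (Dvd.dvd.mul_left ?_ _)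
    simp only [swapVars, MvPolynomial.rename_X]
    rcases eq_or_ne s i with rfl | hi
    · simp
    · rcases eq_or_ne s j with rfl | hj
      · rw [Equiv.swap_apply_right, ← neg_sub (MvPolynomial.X i)]
        exact (dvd_refl _).neg_right
      · rw [Equiv.swap_apply_of_ne_of_ne hi hj]
        simp

/-- The divided difference `(f - s f) / (x_i - x_j)`, where `s` exchanges `x_i` and `x_j`.
For `i ≠ j` the quotient is unique because `x_i - x_j` is not a zero divisor. -/
noncomputable def dividedDifference {σ R : Type*} [CommRing R] [DecidableEq σ] (i j : σ)
    (f : MvPolynomial σ R) : MvPolynomial σ R :=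
  Classical.choose (X_sub_X_dvd_sub_swapVars i j f)

theorem dividedDifference_spec {σ R : Type*} [CommRing R] [DecidableEq σ] (i j : σ)
    (f : MvPolynomial σ R) :
    f - swapVars i j f =
      (MvPolynomial.X i - MvPolynomial.X j) * dividedDifference i j f :=
  Classical.choose_spec (X_sub_X_dvd_sub_swapVars i j f)

/-- `w(i) < w(i+1)`, in one-line notation; positions and values are counted from `0`. -/
def IsAscent {N : ℕ} (w : Equiv.Perm (Fin N)) (i : ℕ) : Prop :=
  ∃ h : i + 1 < N, w ⟨i, Nat.lt_of_succ_lt h⟩ < w ⟨i + 1, h⟩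

/-- The number of pairs of positions `a < b` with `w(a) < w(b)`. -/
def coinversions {N : ℕ} (w : Equiv.Perm (Fin N)) : ℕ :=
  (Finset.univ.filter fun p : Fin N × Fin N => p.1 < p.2 ∧ w p.1 < w p.2).card

theorem coinversions_mul_swap_lt {N : ℕ} (w : Equiv.Perm (Fin N)) (i : ℕ) (h : i + 1 < N)
    (hw : w ⟨i, Nat.lt_of_succ_lt h⟩ < w ⟨i + 1, h⟩) :
    coinversions (w * Equiv.swap ⟨i, Nat.lt_of_succ_lt h⟩ ⟨i + 1, h⟩) < coinversions w := by
  set a : Fin N := ⟨i, Nat.lt_of_succ_lt h⟩ with ha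
  set b : Fin N := ⟨i + 1, h⟩ with hb
  have hab : a < b := by simp [ha, hb]
  unfold coinversions
  set A := Finset.univ.filter fun p : Fin N × Fin N =>
    p.1 < p.2 ∧ (w * Equiv.swap a b) p.1 < (w * Equiv.swap a b) p.2 with hA
  set B := Finset.univ.filter fun p : Fin N × Fin N => p.1 < p.2 ∧ w p.1 < w p.2 with hB
  have hmem : (a, b) ∈ B := by simp [hB, hab, hw]
  refine lt_of_le_of_lt ?_ (Finset.card_erase_lt_of_mem hmem)
  refine Finset.card_le_card_of_injOn
    (fun p => (Equiv.swap a b p.1, Equiv.swap a b p.2)) ?_ ?_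
  · rintro ⟨c, d⟩ hp
    rw [Finset.mem_coe, hA, Finset.mem_filter] at hp
    obtain ⟨-, hcd, hlt⟩ := hp
    simp only [Equiv.Perm.mul_apply] at hcd hlt
    have hne : ¬ (c = a ∧ d = b) := by
      rintro ⟨rfl, rfl⟩
      rw [Equiv.swap_apply_left, Equiv.swap_apply_right] at hlt
      exact absurd hw (not_lt.mpr hlt.le)
    have hlt' : Equiv.swap a b c < Equiv.swap a b d := by
      simp only [Equiv.swap_apply_def]
      simp only [Fin.ext_iff, Fin.lt_def, ha, hb] at hne hcd ⊢
      split_ifs <;> (try dsimp only) <;> omega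
    rw [Finset.mem_coe, Finset.mem_erase, hB, Finset.mem_filter]
    refine ⟨?_, Finset.mem_univ _, hlt', hlt⟩
    intro h12
    obtain ⟨h1, h2⟩ := Prod.mk.inj h12
    rw [Equiv.swap_apply_eq_iff, Equiv.swap_apply_left] at h1
    rw [Equiv.swap_apply_eq_iff, Equiv.swap_apply_right] at h2
    subst h1 h2
    exact absurd hcd (not_lt.mpr hab.le)
  · rintro ⟨c, d⟩ _ ⟨c', d'⟩ _ hEq
    simpa using hEq

open Classical in
/-- The Schubert polynomial of `w ∈ S_N`, in the variables `x_1, …, x_N` (`x_i` is `X (i - 1)`),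
through divided differences: it is `x_1^(N-1) x_2^(N-2) ⋯ x_(N-1)` for the longest
permutation `N (N-1) ⋯ 1`, the only one without ascents, and otherwise it is
`∂_i` of the Schubert polynomial of `w s_i`, where `w s_i` exchanges the entries in positions
`i, i + 1`. Any ascent `i` of `w` gives the same polynomial; the leftmost one is used. -/
noncomputable def schubert (R : Type*) [CommRing R] {N : ℕ} (w : Equiv.Perm (Fin N)) :
    MvPolynomial (Fin N) R :=
  if hw : ∃ i, IsAscent w i then
    dividedDifference ⟨Nat.find hw, Nat.lt_of_succ_lt (Nat.find_spec hw).1⟩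
      ⟨Nat.find hw + 1, (Nat.find_spec hw).1⟩
      (schubert R (w * Equiv.swap ⟨Nat.find hw, Nat.lt_of_succ_lt (Nat.find_spec hw).1⟩
        ⟨Nat.find hw + 1, (Nat.find_spec hw).1⟩))
  else ∏ i : Fin N, MvPolynomial.X i ^ (N - 1 - (i : ℕ))
termination_by coinversions w
decreasing_by
  exact coinversions_mul_swap_lt w _ (Nat.find_spec hw).1 (Nat.find_spec hw).2

/-- The permutations `π` of `{1, …, n + k}` all of whose descents occur weakly left of
position `n` and with `1, …, r` all among the entries `π_1, …, π_n`. -/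
def schubertIndex (n k r : ℕ) : Set (Equiv.Perm (Fin (n + k))) :=
  {π | (∀ i j : Fin (n + k), (j : ℕ) = i + 1 → π j < π i → (i : ℕ) < n) ∧
    ∀ v : Fin (n + k), (v : ℕ) < r → ∃ i : Fin (n + k), (i : ℕ) < n ∧ π i = v}

/-- The reversed Schubert polynomial, in the variables `x_1, …, x_n`: substitute
`x_(n+1-i)` for `x_i` if `i ≤ n`, and `0` for the variables `x_(n+1), …, x_(n+k)`, which do not
occur in the Schubert polynomial of a permutation without descents after position `n`. -/
noncomputable def reversedSchubert (R : Type*) [CommRing R] (n k : ℕ)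
    (π : Equiv.Perm (Fin (n + k))) : MvPolynomial (Fin n) R :=
  MvPolynomial.aeval
    (Fin.addCases (fun i : Fin n => (MvPolynomial.X i.rev : MvPolynomial (Fin n) R))
      (fun _ : Fin k => 0))
    (schubert R π)

/-- For `S = {s_1 < ⋯ < s_m} ⊆ {1, …, n}`, the skip monomial
`x_(s_1)^(s_1) x_(s_2)^(s_2 - 1) ⋯ x_(s_m)^(s_m - m + 1)`: the exponent at `s ∈ S` is `s` minus
the number of elements of `S` below `s`. -/
noncomputable def skipMonomial (R : Type*) [CommRing R] {n : ℕ} (S : Finset (Fin n)) :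
    MvPolynomial (Fin n) R :=
  ∏ s ∈ S, MvPolynomial.X s ^ ((s : ℕ) + 1 - (S.filter fun t => t < s).card)

/-- The set of `(n, k, r)`-good monomials. -/
def goodMonomials (R : Type*) [CommRing R] (n k r : ℕ) : Set (MvPolynomial (Fin n) R) :=
  {p | (∃ e : Fin n →₀ ℕ, p = MvPolynomial.monomial e 1) ∧
    (∀ S : Finset (Fin n), S.card + r = n + 1 → ¬ skipMonomial R S ∣ p) ∧
    ∀ i : Fin n, ¬ (MvPolynomial.X i ^ (k + ((i : ℕ) + 1)) : MvPolynomial (Fin n) R) ∣ p}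

/-- The ideal generated by `h_(k+1), …, h_(k+n)` and `e_(n-r+1), …, e_n`. -/
noncomputable def idealI (R : Type*) [CommRing R] (n k r : ℕ) : Ideal (MvPolynomial (Fin n) R) :=
  Ideal.span
    ({p | ∃ d : ℕ, k + 1 ≤ d ∧ d ≤ k + n ∧ p = MvPolynomial.hsymm (Fin n) R d} ∪
      {p | ∃ d : ℕ, n + 1 ≤ d + r ∧ d ≤ n ∧ p = MvPolynomial.esymm (Fin n) R d})

/-- The quotient of the polynomial ring in `x_1, …, x_n` by this ideal. -/
abbrev quotientR (R : Type*) [CommRing R] (n k r : ℕ) : Type _ :=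
  MvPolynomial (Fin n) R ⧸ idealI R n k r

/-! The reversed Schubert polynomials span the quotient, and there are at most as many of them as
its dimension; such a family is a basis.

Spanning: in the lexicographic order whose largest variable is the last one, the Schubert polynomial
of π has leading exponent the Lehmer code of π, with coefficient 1 (`isTopExponent_schubert`).
Reversing the variables turns this into the stated order (`degree_reversedSchubert`). The reversed
codes of the index set are exactly the good exponents (`image_reversedCode`), which gives the
equality of sets. Every other exponent is the leading exponent of an element of the ideal
(`exists_mem_idealI_of_not_mem_goodExponents`): of a multiple of some h_(k+i)(x_i, …, x_n), or of a
multiple of a determinant of complete symmetric polynomials that lies in the ideal and has leading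
monomial x(S). So every monomial leads an element of the ideal or a reversed Schubert polynomial,
and division by leading terms shows that the latter span.

Counting, by orbit harmonics: label 1, …, n + k by distinct scalars. The first n entries of each π
in the index set give a point, and distinct π give distinct points. Each generator of the ideal is
the top degree part of a polynomial vanishing at all these points, so monomials that span the
quotient also span the functions on the points (`span_monomial_sup_eq_top`). Hence the index set is
no larger than the dimension. Scalars are taken in the algebraic closure, since the field may be
finite. -/

open MvPolynomial

/-! ### Divided differences of monomials. -/

section DividedDifference

variable {σ R : Type*} [CommRing R] [IsDomain R] [DecidableEq σ]

theorem dividedDifference_eq_of_mul_eq {i j : σ} (hij : i ≠ j) {f g : MvPolynomial σ R}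
    (h : f - swapVars i j f = (X i - X j) * g) : dividedDifference i j f = g := by
  have hX : (X i - X j : MvPolynomial σ R) ≠ 0 :=
    sub_ne_zero.mpr fun h => hij (X_injective h)
  exact mul_left_cancel₀ hX ((dividedDifference_spec i j f).symm.trans h)

theorem dividedDifference_sum {i j : σ} (hij : i ≠ j) {ι : Type*} (s : Finset ι)
    (f : ι → MvPolynomial σ R) :
    dividedDifference i j (∑ a ∈ s, f a) = ∑ a ∈ s, dividedDifference i j (f a) := by
  apply dividedDifference_eq_of_mul_eq hij
  rw [map_sum, ← Finset.sum_sub_distrib, Finset.mul_sum]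
  exact Finset.sum_congr rfl fun a _ => dividedDifference_spec i j (f a)

theorem dividedDifference_swapVars {i j : σ} (hij : i ≠ j) (f : MvPolynomial σ R) :
    dividedDifference i j (swapVars i j f) = -dividedDifference i j f := by
  apply dividedDifference_eq_of_mul_eq hij
  have h : swapVars i j (swapVars i j f) = f := by
    simp only [swapVars, rename_rename]
    convert! rename_id_apply f using 2
    ext; simp
  rw [h, mul_neg, ← dividedDifference_spec, neg_sub]

/-- Lowering the `i`-entry of `d` to `d j` splits off a factor symmetric in the two variables, so
only (x_i^m - x_j^m) / (x_i - x_j) remains, a geometric sum. -/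
theorem dividedDifference_monomial {i j : σ} (hij : i ≠ j) (d : σ →₀ ℕ) (a : R) (m : ℕ)
    (hd : d j + m = d i) :
    dividedDifference i j (monomial d a) = ∑ s ∈ Finset.range m,
      monomial ((d.update i (d j + s)).update j (d j + (m - 1 - s))) a := by
  apply dividedDifference_eq_of_mul_eq hij
  set b : σ →₀ ℕ := d.update i (d j) with hb
  have h1 : monomial d a = monomial b a * X i ^ m := by
    rw [X_pow_eq_monomial, monomial_mul, mul_one]
    congr 2
    ext l
    by_cases hl : l = i
    · subst hl; simp [hb, hd]
    · simp [hb, hl]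
  have h2 : swapVars i j (monomial b a) = monomial b a := by
    rw [swapVars, rename_monomial]
    congr 2
    ext l
    rw [Finsupp.mapDomain_equiv_apply, Equiv.symm_swap]
    by_cases hl : l = i
    · subst hl; simp [hb, Finsupp.update_apply, hij.symm]
    · by_cases hl' : l = j
      · subst hl'; simp [hb, Finsupp.update_apply, hij.symm]
      · rw [Equiv.swap_apply_of_ne_of_ne hl hl']
  have h3 : swapVars i j (X i ^ m : MvPolynomial σ R) = X j ^ m := by
    simp [swapVars]
  rw [h1, map_mul, h2, h3, ← mul_sub, ← (Commute.all (X i) (X j)).mul_geom_sum₂ m, mul_left_comm,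
    Finset.mul_sum]
  congr 1
  refine Finset.sum_congr rfl fun s hs => ?_
  rw [X_pow_eq_monomial, X_pow_eq_monomial, monomial_mul, monomial_mul, mul_one, mul_one]
  congr 2
  ext l
  by_cases hl : l = i
  · subst hl; simp [hb, Finsupp.update_apply, hij]
  · by_cases hl' : l = j
    · subst hl'; simp [hb, Finsupp.update_apply, hij.symm]
    · simp [hb, Finsupp.update_apply, hl, hl']

theorem mem_support_dividedDifference_monomial {i j : σ} (hij : i ≠ j) {d e : σ →₀ ℕ} {a : R}
    (he : e ∈ (dividedDifference i j (monomial d a)).support) :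
    (∀ l, l ≠ i → l ≠ j → e l = d l) ∧ e j < max (d i) (d j) ∧ e i + e j + 1 = d i + d j := by
  wlog h : d j ≤ d i generalizing d
  · have hs : swapVars i j (monomial d a) =
        monomial (Finsupp.equivMapDomain (Equiv.swap i j) d) a := by
      rw [swapVars, rename_monomial, Finsupp.equivMapDomain_eq_mapDomain]
    have := @this (Finsupp.equivMapDomain (Equiv.swap i j) d) (by
      rw [← hs, dividedDifference_swapVars hij]; simpa using he)
      (by simp [Finsupp.equivMapDomain_apply]; omega)
    simp only [Finsupp.equivMapDomain_apply, Equiv.symm_swap, Equiv.swap_apply_left,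
      Equiv.swap_apply_right] at this
    refine ⟨fun l hl hl' => ?_, by omega, by omega⟩
    rw [this.1 l hl hl', Equiv.swap_apply_of_ne_of_ne hl hl']
  obtain ⟨m, hm⟩ := Nat.exists_eq_add_of_le h
  rw [dividedDifference_monomial hij d a m hm.symm] at he
  obtain ⟨s, hs, he⟩ := Finset.mem_biUnion.mp (support_sum he)
  have he := Finset.mem_singleton.mp (support_monomial_subset he)
  rw [Finset.mem_range] at hs
  subst he
  refine ⟨fun l hl hl' => ?_, ?_, ?_⟩
  · simp [Finsupp.update_apply, hl, hl']
  · simp [Finsupp.update_apply]; omega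
  · simp [Finsupp.update_apply, hij]; omega

/-- This is the term `s = 0` of the geometric sum, the one with the highest power of x_j; `e i ≤ e
j` forces `d j < d i`, so the sum is not empty. -/
theorem coeff_dividedDifference_monomial {i j : σ} (hij : i ≠ j) {d e : σ →₀ ℕ} {a : R}
    (hd : ∀ l, l ≠ i → l ≠ j → e l = d l) (hi : e i = d j) (hj : e j + 1 = d i)
    (h : e i ≤ e j) : coeff e (dividedDifference i j (monomial d a)) = a := by
  obtain ⟨m, hm⟩ := Nat.exists_eq_add_of_le (show d j ≤ d i by omega)
  have key : ∀ s < m, ((d.update i (d j + s)).update j (d j + (m - 1 - s)) = e ↔ s = 0) := by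
    intro s hs
    constructor
    · intro hE
      have := DFunLike.congr_fun hE i
      simp [Finsupp.update_apply, hij] at this
      omega
    · rintro rfl
      ext l
      by_cases hl : l = i
      · subst hl; simp [Finsupp.update_apply, hij, hi]
      · by_cases hl' : l = j
        · subst hl'; simp [Finsupp.update_apply]; omega
        · simp [Finsupp.update_apply, hl, hl', hd]
  rw [dividedDifference_monomial hij d a m hm.symm, coeff_sum,
    Finset.sum_eq_single_of_mem 0 (Finset.mem_range.mpr (by omega))]
  · rw [coeff_monomial, if_pos ((key 0 (by omega)).mpr rfl)]
  · intro s hs hs0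
    rw [coeff_monomial, if_neg (mt (key s (Finset.mem_range.mp hs)).mp hs0)]

end DividedDifference

/-! ### Leading terms of Schubert polynomials. -/

section SchubertLeading

variable {R : Type*} [CommRing R] {N : ℕ}

/-- The exponent `c` occurs in `f` with coefficient `1`, and at the largest index `j` where another
exponent `d` of `f` differs from `c`, the entry of `d` is smaller and `P j` holds. -/
def IsTopExponent (f : MvPolynomial (Fin N) R) (c : Fin N →₀ ℕ) (P : Fin N → Prop) : Prop :=
  coeff c f = 1 ∧ ∀ d ∈ f.support, d ≠ c → ∃ j, P j ∧ d j < c j ∧ ∀ l, j < l → d l = c l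

theorem IsTopExponent.mono {f : MvPolynomial (Fin N) R} {c : Fin N →₀ ℕ} {P Q : Fin N → Prop}
    (h : IsTopExponent f c P) (hPQ : ∀ j, P j → Q j) : IsTopExponent f c Q :=
  ⟨h.1, fun d hd hdc => (h.2 d hd hdc).imp fun _ hj => ⟨hPQ _ hj.1, hj.2⟩⟩

/-- Leading terms do not survive divided differences in general: an exponent that is smaller at `q`
may have a large `i`-entry, which the operator can move to `q`. The predicate on the place of
difference excludes this. If `d` drops below `b` at `i`, then `d q = c i ≤ c q` and `d i ≤ c q`, so
all exponents produced from `d` are below `c q` at `q`. Differences at `j ≥ M` are left alone, as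
`i` and `q` are below `M`. -/
theorem IsTopExponent.dividedDifference [IsDomain R] {f : MvPolynomial (Fin N) R}
    {b c : Fin N →₀ ℕ} {i q : Fin N} (hiq : (q : ℕ) = i + 1) {M : ℕ} (hM : (q : ℕ) < M)
    (hf : IsTopExponent f b fun j => j = i ∨ M ≤ j)
    (hbc : ∀ l, l ≠ i → l ≠ q → b l = c l) (hi : b i = c q + 1) (hq : b q = c i)
    (hc : c i ≤ c q) :
    IsTopExponent (dividedDifference i q f) c fun j => j = q ∨ M ≤ j := by
  have hne : i ≠ q := by rintro rfl; omega
  have hlt : ∀ d ∈ f.support, d ≠ b →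
      ∀ e ∈ (_root_.dividedDifference i q (monomial d (coeff d f))).support,
      ∃ j, (j = q ∨ M ≤ j) ∧ e j < c j ∧ ∀ l, j < l → e l = c l := by
    intro d hd hdb e he
    obtain ⟨he1, he2, he3⟩ := mem_support_dividedDifference_monomial hne he
    obtain ⟨j, rfl | hj, hj1, hj2⟩ := hf.2 d hd hdb
    · have hjq := hj2 q (by rw [Fin.lt_def]; omega)
      refine ⟨q, Or.inl rfl, by omega, fun l hl => ?_⟩
      rw [Fin.lt_def] at hl
      have hl1 : l ≠ j := by rintro rfl; omega
      have hl2 : l ≠ q := by rintro rfl; omega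
      rw [he1 l hl1 hl2, hj2 l (by rw [Fin.lt_def]; omega), hbc l hl1 hl2]
    · have key : ∀ l, j ≤ l → e l = d l ∧ b l = c l := fun l hl => by
        rw [Fin.le_def] at hl
        have hl1 : l ≠ i := by rintro rfl; omega
        have hl2 : l ≠ q := by rintro rfl; omega
        exact ⟨he1 l hl1 hl2, hbc l hl1 hl2⟩
      refine ⟨j, Or.inr hj, ?_, fun l hl => ?_⟩
      · rw [(key j le_rfl).1, ← (key j le_rfl).2]; exact hj1
      · rw [(key l hl.le).1, ← (key l hl.le).2]; exact hj2 l hl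
  have hsum : _root_.dividedDifference i q f =
      ∑ d ∈ f.support, _root_.dividedDifference i q (monomial d (coeff d f)) := by
    conv_lhs => rw [f.as_sum]
    exact dividedDifference_sum hne _ _
  constructor
  · have hb : coeff c (_root_.dividedDifference i q (monomial b (coeff b f))) = 1 := by
      rw [coeff_dividedDifference_monomial hne (fun l h1 h2 => (hbc l h1 h2).symm) hq.symm hi.symm
        hc, hf.1]
    rw [hsum, coeff_sum]
    by_cases hbs : b ∈ f.support
    · rw [Finset.sum_eq_single_of_mem b hbs, hb]
      intro d hd hdb
      by_contra h
      obtain ⟨j, -, hj, -⟩ := hlt d hd hdb c (mem_support_iff.mpr h)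
      exact hj.false
    · rw [notMem_support_iff, hf.1] at hbs
      have := subsingleton_of_zero_eq_one hbs.symm
      exact Subsingleton.elim _ _
  · intro e he hec
    rw [hsum] at he
    obtain ⟨d, hd, he⟩ := Finset.mem_biUnion.mp (support_sum he)
    by_cases hdb : d = b
    · subst hdb
      obtain ⟨he1, he2, he3⟩ := mem_support_dividedDifference_monomial hne he
      refine ⟨q, Or.inl rfl, ?_, fun l hl => ?_⟩
      · by_contra hq'
        apply hec
        ext l
        by_cases hl1 : l = i
        · subst hl1; omega
        · by_cases hl2 : l = q
          · subst hl2; omega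
          · rw [he1 l hl1 hl2, hbc l hl1 hl2]
      · rw [Fin.lt_def] at hl
        have hl1 : l ≠ i := by rintro rfl; omega
        have hl2 : l ≠ q := by rintro rfl; omega
        rw [he1 l hl1 hl2, hbc l hl1 hl2]
    · exact hlt d hd hdb e he

/-- The Lehmer code: its entry at `i` counts the positions `j > i` with `w j < w i`. -/
noncomputable def lehmerCode (w : Equiv.Perm (Fin N)) : Fin N →₀ ℕ :=
  Finsupp.equivFunOnFinite.symm fun i => (Finset.univ.filter fun j => i < j ∧ w j < w i).card

theorem lehmerCode_apply (w : Equiv.Perm (Fin N)) (i : Fin N) :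
    lehmerCode w i = (Finset.univ.filter fun j => i < j ∧ w j < w i).card := rfl

theorem lehmerCode_le_of_lt (w : Equiv.Perm (Fin N)) {i q : Fin N} (hiq : (q : ℕ) = i + 1)
    (h : w i < w q) : lehmerCode w i ≤ lehmerCode w q := by
  rw [lehmerCode_apply, lehmerCode_apply]
  refine Finset.card_le_card fun j => ?_
  simp only [Finset.mem_filter, Finset.mem_univ, true_and, Fin.lt_def] at *
  rintro ⟨h1, h2⟩
  have : j ≠ q := by rintro rfl; omega
  have : (j : ℕ) ≠ q := fun h => this (Fin.ext h)
  omega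

theorem lehmerCode_mul_swap_left (w : Equiv.Perm (Fin N)) {i q : Fin N} (hiq : (q : ℕ) = i + 1)
    (h : w i < w q) : lehmerCode (w * Equiv.swap i q) i = lehmerCode w q + 1 := by
  have hne : i ≠ q := by rintro rfl; omega
  rw [lehmerCode_apply, lehmerCode_apply, ← Finset.card_insert_of_notMem (a := q) (by simp)]
  congr 1
  ext j
  simp only [Finset.mem_filter, Finset.mem_univ, true_and, Finset.mem_insert,
    Equiv.Perm.mul_apply, Equiv.swap_apply_left]
  by_cases hj : j = q
  · subst hj; simp [h, show i < j by rw [Fin.lt_def]; omega]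
  · by_cases hj' : j = i
    · subst hj'
      simp only [lt_irrefl, hne, false_and, false_or, false_iff, not_and, Fin.lt_def]
      omega
    · rw [Equiv.swap_apply_of_ne_of_ne hj' hj]
      have h1 : (j : ℕ) ≠ q := fun h => hj (Fin.ext h)
      simp only [Fin.lt_def, hj, false_or]
      have : (i : ℕ) < j ↔ (q : ℕ) < j := by omega
      rw [this]

theorem lehmerCode_mul_swap_right (w : Equiv.Perm (Fin N)) {i q : Fin N} (hiq : (q : ℕ) = i + 1)
    (h : w i < w q) : lehmerCode (w * Equiv.swap i q) q = lehmerCode w i := by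
  have hne : i ≠ q := by rintro rfl; omega
  rw [lehmerCode_apply, lehmerCode_apply]
  congr 1
  ext j
  simp only [Finset.mem_filter, Finset.mem_univ, true_and,
    Equiv.Perm.mul_apply, Equiv.swap_apply_right]
  by_cases hj : j = q
  · subst hj; simp [h.le]
  · by_cases hj' : j = i
    · subst hj'
      simp only [lt_irrefl, false_and, iff_false, not_and, Fin.lt_def]
      omega
    · rw [Equiv.swap_apply_of_ne_of_ne hj' hj]
      have h1 : (j : ℕ) ≠ q := fun h => hj (Fin.ext h)
      simp only [Fin.lt_def]
      have : (i : ℕ) < j ↔ (q : ℕ) < j := by omega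
      rw [this]

theorem lehmerCode_mul_swap_of_ne (w : Equiv.Perm (Fin N)) {i q : Fin N} (hiq : (q : ℕ) = i + 1)
    {l : Fin N} (hi : l ≠ i) (hq : l ≠ q) :
    lehmerCode (w * Equiv.swap i q) l = lehmerCode w l := by
  rw [lehmerCode_apply, lehmerCode_apply]
  refine Finset.card_equiv (Equiv.swap i q) fun j => ?_
  simp only [Finset.mem_filter, Finset.mem_univ, true_and, Equiv.Perm.mul_apply,
    Equiv.swap_apply_of_ne_of_ne hi hq, and_congr_left_iff]
  intro _
  have h1 : (l : ℕ) ≠ i := fun h => hi (Fin.ext h)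
  have h2 : (l : ℕ) ≠ q := fun h => hq (Fin.ext h)
  simp only [Equiv.swap_apply_def, Fin.lt_def, Fin.ext_iff]
  split_ifs <;> omega

theorem schubert_of_first_ascent (w : Equiv.Perm (Fin N)) {i q : Fin N} (hiq : (q : ℕ) = i + 1)
    (h : w i < w q) (hmin : ∀ j < (i : ℕ), ¬ IsAscent w j) :
    schubert R w = dividedDifference i q (schubert R (w * Equiv.swap i q)) := by
  classical
  obtain ⟨i, hi⟩ := i
  obtain ⟨q, hq⟩ := q
  simp only at hiq
  subst hiq
  have hw : ∃ i, IsAscent w i := ⟨i, hq, h⟩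
  have hfind : Nat.find hw = i := (Nat.find_eq_iff hw).mpr ⟨⟨hq, h⟩, hmin⟩
  rw [schubert, dif_pos hw]
  simp only [hfind]

/-- The recursion of `schubert` is an insertion sort into decreasing order: the first `M` entries
decrease, except perhaps for the entry at `q`, still being inserted. If `w` ascends into `q`, this
is its leftmost ascent, and the exchange moves the exceptional position to `q - 1`. Otherwise the
whole prefix decreases, and the prefix is lengthened by one entry, which becomes the exceptional
one. The place of difference is thus always where `IsTopExponent.dividedDifference` needs it. -/
theorem isTopExponent_schubert_of_prefix [IsDomain R] (w : Equiv.Perm (Fin N)) (q : Fin N) (M : ℕ)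
    (hqM : (q : ℕ) < M) (hMN : M ≤ N)
    (hw : ∀ a b : Fin N, a < b → (b : ℕ) < M → b ≠ q → w b < w a) :
    IsTopExponent (schubert R w) (lehmerCode w) fun j => j = q ∨ M ≤ j := by
  induction hc : coinversions w using Nat.strong_induction_on generalizing w q M with
  | _ c ih =>
  induction hd : N - M using Nat.strong_induction_on generalizing q M with
  | _ D ihD =>
  by_cases hA : ∃ i : Fin N, (q : ℕ) = i + 1 ∧ w i < w q
  · obtain ⟨i, hiq, h⟩ := hA
    have hne : i ≠ q := by rintro rfl; omega
    have hmin : ∀ j < (i : ℕ), ¬ IsAscent w j := by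
      rintro j hj ⟨hjN, hlt⟩
      refine hlt.asymm (hw _ _ ?_ ?_ ?_)
      · rw [Fin.lt_def]; simp
      · simp only; omega
      · rw [Ne, Fin.ext_iff]; simp only; omega
    have hlt : coinversions (w * Equiv.swap i q) < coinversions w := by
      have hqN := q.2
      obtain ⟨i, hi⟩ := i
      obtain ⟨q, hq⟩ := q
      simp only at hiq
      subst hiq
      exact coinversions_mul_swap_lt w i hq h
    rw [schubert_of_first_ascent w hiq h hmin]
    refine IsTopExponent.dividedDifference hiq hqM
      (ih _ (hc ▸ hlt) (w * Equiv.swap i q) i M (by omega) hMN ?_ rfl)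
      (fun l hi hq => lehmerCode_mul_swap_of_ne w hiq hi hq) (lehmerCode_mul_swap_left w hiq h)
      (lehmerCode_mul_swap_right w hiq h) (lehmerCode_le_of_lt w hiq h)
    intro a b hab hbM hbi
    simp only [Equiv.Perm.mul_apply]
    have hab' := Fin.lt_def.mp hab
    by_cases hbq : b = q
    · subst hbq
      rw [Equiv.swap_apply_right]
      by_cases hai : a = i
      · subst hai; rwa [Equiv.swap_apply_left]
      · rw [Equiv.swap_apply_of_ne_of_ne hai hab.ne]
        have : (a : ℕ) ≠ i := fun h => hai (Fin.ext h)
        exact hw a i (by rw [Fin.lt_def]; omega) (by omega) hne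
    · rw [Equiv.swap_apply_of_ne_of_ne hbi hbq]
      have h1 : (b : ℕ) ≠ i := fun h => hbi (Fin.ext h)
      have h2 : (b : ℕ) ≠ q := fun h => hbq (Fin.ext h)
      refine hw _ b ?_ hbM hbq
      simp only [Equiv.swap_apply_def, Fin.lt_def, Fin.ext_iff]
      split_ifs <;> omega
  · have hdec : ∀ a b : Fin N, a < b → (b : ℕ) < M → w b < w a := by
      intro a b hab hbM
      by_cases hbq : b = q
      · subst hbq
        have hab' := Fin.lt_def.mp hab
        have hb := b.2
        let i : Fin N := ⟨b - 1, by omega⟩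
        have hi : (b : ℕ) = i + 1 := by simp only [i]; omega
        have hib : w b < w i := by
          refine lt_of_le_of_ne (not_lt.mp fun h => hA ⟨i, hi, h⟩) fun h => ?_
          have := congrArg Fin.val (w.injective h)
          omega
        by_cases hai : a = i
        · rwa [hai]
        · have : (a : ℕ) ≠ i := fun h => hai (Fin.ext h)
          refine hib.trans (hw a i (by rw [Fin.lt_def]; omega) (by omega) ?_)
          rw [Ne, Fin.ext_iff]; omega
      · exact hw a b hab hbM hbq
    rcases hMN.eq_or_lt with rfl | hlt
    · have hno : ¬ ∃ i, IsAscent w i := by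
        rintro ⟨i, hi, hi'⟩
        exact hi'.asymm (hdec _ _ (by rw [Fin.lt_def]; simp) hi)
      have hcode : lehmerCode w = Finsupp.equivFunOnFinite.symm fun i : Fin M => M - 1 - (i : ℕ) := by
        ext i
        rw [lehmerCode_apply, Finsupp.coe_equivFunOnFinite_symm, ← Fin.card_Ioi]
        congr 1
        ext j
        simp only [Finset.mem_filter, Finset.mem_univ, true_and, Finset.mem_Ioi,
          and_iff_left_iff_imp]
        exact fun hij => hdec i j hij j.2
      have hS : schubert R w = monomial (lehmerCode w) 1 := by
        rw [schubert, dif_neg hno, monomial_eq, C_1, one_mul, Finsupp.prod_fintype _ _ (by simp),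
          hcode]
        simp
      rw [hS]
      refine ⟨by simp, fun d hd hdc => ?_⟩
      exact absurd (Finset.mem_singleton.mp (support_monomial_subset hd)) hdc
    · refine (ihD (N - (M + 1)) (by omega) ⟨M, hlt⟩ (M + 1) (by simp) (by omega) ?_ rfl).mono ?_
      · intro a b hab hb hbM
        refine hdec a b hab ?_
        have : (b : ℕ) ≠ M := fun h => hbM (Fin.ext h)
        omega
      · rintro j (rfl | hj)
        · exact Or.inr le_rfl
        · exact Or.inr (by omega)

theorem isTopExponent_schubert [IsDomain R] (w : Equiv.Perm (Fin N)) :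
    IsTopExponent (schubert R w) (lehmerCode w) fun _ => True := by
  rcases Nat.eq_zero_or_pos N with rfl | hN
  · have hno : ¬ ∃ i, IsAscent w i := by
      rintro ⟨i, hi, -⟩
      omega
    rw [schubert, dif_neg hno]
    refine ⟨?_, fun d _ hd => absurd (Subsingleton.elim _ _) hd⟩
    rw [Finset.univ_eq_empty, Finset.prod_empty, Subsingleton.elim (lehmerCode w) 0]
    simp
  · refine (isTopExponent_schubert_of_prefix w ⟨0, hN⟩ 1 (by simp) hN ?_).mono fun _ _ => trivial
    intro a b _ hb hb0
    exact absurd (Fin.ext (by simpa using hb)) hb0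

theorem lex_lt_of_forall_lt {σ : Type*} [LinearOrder σ] [WellFoundedGT σ] {c d : σ →₀ ℕ} (j : σ)
    (hj : d j < c j) (h : ∀ l, l < j → d l = c l) :
    MonomialOrder.lex.toSyn d < MonomialOrder.lex.toSyn c := by
  rw [MonomialOrder.lex_lt_iff]
  exact Finsupp.lex_def.mpr ⟨j, fun l hl => h l hl, hj⟩

theorem degree_eq_of_coeff_of_lt {σ : Type*} [Nontrivial R] {m : MonomialOrder σ}
    {f : MvPolynomial σ R} {c : σ →₀ ℕ} (hc : coeff c f = 1)
    (h : ∀ d ∈ f.support, d ≠ c → m.toSyn d < m.toSyn c) : m.degree f = c ∧ m.Monic f := by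
  have hcs : c ∈ f.support := by rw [mem_support_iff, hc]; exact one_ne_zero
  have hdeg : m.degree f = c := by
    by_contra hne
    have hmem : m.degree f ∈ f.support := m.degree_mem_support fun hf => by simp [hf] at hcs
    exact (h _ hmem hne).not_ge (m.le_degree hcs)
  exact ⟨hdeg, by rw [MonomialOrder.Monic, MonomialOrder.leadingCoeff, hdeg, hc]⟩

/-- The first `n` entries of the Lehmer code, in reversed order. -/
noncomputable def reversedCode {n k : ℕ} (π : Equiv.Perm (Fin (n + k))) : Fin n →₀ ℕ :=
  Finsupp.equivFunOnFinite.symm fun i => lehmerCode π (Fin.castAdd k i.rev)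

theorem reversedCode_apply {n k : ℕ} (π : Equiv.Perm (Fin (n + k))) (i : Fin n) :
    reversedCode π i = lehmerCode π (Fin.castAdd k i.rev) := rfl

theorem apply_lt_apply_of_mem_schubertIndex {n k r : ℕ} {π : Equiv.Perm (Fin (n + k))}
    (hπ : π ∈ schubertIndex n k r) {a b : Fin (n + k)} (ha : n ≤ (a : ℕ)) (hab : a < b) :
    π a < π b := by
  obtain ⟨b, hb⟩ := b
  rw [Fin.lt_def] at hab
  induction b with
  | zero => simp at hab
  | succ b ih =>
    have hstep : n ≤ b → π ⟨b, by omega⟩ < π ⟨b + 1, hb⟩ := fun hnb => by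
      refine lt_of_le_of_ne (not_lt.mp fun h => ?_) fun h => ?_
      · have := hπ.1 ⟨b, by omega⟩ ⟨b + 1, hb⟩ rfl h
        simp only at this; omega
      · have := congrArg Fin.val (π.injective h)
        simp at this
    simp only at hab
    rcases (Nat.lt_succ_iff.mp hab).eq_or_lt with h | h
    · subst h; exact hstep ha
    · exact (ih (by omega) h).trans (hstep (by omega))

theorem lehmerCode_natAdd_eq_zero {n k r : ℕ} {π : Equiv.Perm (Fin (n + k))}
    (hπ : π ∈ schubertIndex n k r) (l : Fin k) : lehmerCode π (Fin.natAdd n l) = 0 := by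
  rw [lehmerCode_apply, Finset.card_eq_zero, Finset.filter_eq_empty_iff]
  rintro j - ⟨h1, h2⟩
  exact h2.asymm (apply_lt_apply_of_mem_schubertIndex hπ (by simp) h1)

theorem degree_reversedSchubert [IsDomain R] {n k r : ℕ} {π : Equiv.Perm (Fin (n + k))}
    (hπ : π ∈ schubertIndex n k r) :
    MonomialOrder.lex.degree (reversedSchubert R n k π) = reversedCode π ∧
      MonomialOrder.lex.Monic (reversedSchubert R n k π) := by
  set f := schubert R π with hf
  have htop := isTopExponent_schubert (R := R) π
  -- The code vanishes from position `n` on, and another exponent can leave it there only by being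
  -- smaller; so the variables set to `0` do not occur.
  have hzero : ∀ d ∈ f.support, ∀ l : Fin k, d (Fin.natAdd n l) = 0 := by
    intro d hd l
    by_cases hdc : d = lehmerCode π
    · rw [hdc, lehmerCode_natAdd_eq_zero hπ]
    · obtain ⟨j, -, hj, hj'⟩ := htop.2 d hd hdc
      have hjn : (j : ℕ) < n := by
        by_contra hjn
        have hk := j.2
        have : j = Fin.natAdd n ⟨j - n, by omega⟩ := Fin.ext (by simp; omega)
        rw [this, lehmerCode_natAdd_eq_zero hπ] at hj
        omega
      rw [hj' _ (by rw [Fin.lt_def]; simp; omega), lehmerCode_natAdd_eq_zero hπ]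
  let φ : (Fin (n + k) →₀ ℕ) → (Fin n →₀ ℕ) := fun d =>
    Finsupp.equivFunOnFinite.symm fun i => d (Fin.castAdd k i.rev)
  have hφ : ∀ d i, φ d i = d (Fin.castAdd k i.rev) := fun _ _ => rfl
  have hsum : reversedSchubert R n k π = ∑ d ∈ f.support, monomial (φ d) (coeff d f) := by
    rw [reversedSchubert, ← hf]
    conv_lhs => rw [f.as_sum]
    rw [map_sum]
    refine Finset.sum_congr rfl fun d hd => ?_
    rw [aeval_monomial, Finsupp.prod_fintype _ _ (by simp), Fin.prod_univ_add, monomial_eq,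
      Finsupp.prod_fintype _ _ (by simp), algebraMap_eq]
    simp only [Fin.addCases_left, Fin.addCases_right, hzero d hd, pow_zero, Finset.prod_const_one,
      mul_one]
    congr 1
    refine Fintype.prod_equiv Fin.revPerm _ _ fun i => ?_
    simp [hφ]
  have hlt : ∀ d ∈ f.support, d ≠ lehmerCode π →
      MonomialOrder.lex.toSyn (φ d) < MonomialOrder.lex.toSyn (reversedCode π) := by
    intro d hd hdc
    obtain ⟨j, -, hj, hj'⟩ := htop.2 d hd hdc
    have hjn : (j : ℕ) < n := by
      by_contra hjn
      have hk := j.2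
      have : j = Fin.natAdd n ⟨j - n, by omega⟩ := Fin.ext (by simp; omega)
      rw [this, lehmerCode_natAdd_eq_zero hπ] at hj
      omega
    have hjj : Fin.castAdd k (Fin.rev (Fin.rev ⟨j, hjn⟩ : Fin n)) = j := by simp
    refine lex_lt_of_forall_lt (Fin.rev ⟨j, hjn⟩) ?_ fun l hl => ?_
    · rw [hφ, reversedCode_apply, hjj]; exact hj
    · rw [hφ, reversedCode_apply]
      refine hj' _ ?_
      rw [Fin.lt_def] at hl ⊢
      simp only [Fin.val_rev, Fin.val_castAdd] at hl ⊢
      omega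
  apply degree_eq_of_coeff_of_lt
  · rw [hsum, coeff_sum, Finset.sum_eq_single_of_mem (lehmerCode π)]
    · rw [coeff_monomial, if_pos (by rfl), htop.1]
    · rw [mem_support_iff, htop.1]; exact one_ne_zero
    · intro d hd hdc
      rw [coeff_monomial, if_neg]
      intro h
      have := hlt d hd hdc
      rw [h] at this
      exact this.false
  · intro e he hec
    rw [hsum] at he
    obtain ⟨d, hd, he⟩ := Finset.mem_biUnion.mp (support_sum he)
    rw [Finset.mem_singleton.mp (support_monomial_subset he)] at hec ⊢
    exact hlt d hd fun h => hec (by rw [h]; rfl)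

end SchubertLeading

/-! ### Lehmer codes and good exponents. -/

section Codes

theorem lehmerCode_le {N : ℕ} (w : Equiv.Perm (Fin N)) (i : Fin N) :
    lehmerCode w i ≤ N - 1 - i := by
  rw [lehmerCode_apply, ← Fin.card_Ioi]
  refine Finset.card_le_card fun j hj => ?_
  simp only [Finset.mem_filter, Finset.mem_univ, true_and] at hj
  exact Finset.mem_Ioi.mpr hj.1

/-- The first entry must be `c 0`; `succAbove` fits the remaining ones around it without changing
their relative order. -/
theorem exists_lehmerCode_eq {N : ℕ} (c : Fin N → ℕ) (hc : ∀ i, c i ≤ N - 1 - i) :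
    ∃ w : Equiv.Perm (Fin N), ∀ i, lehmerCode w i = c i := by
  induction N with
  | zero => exact ⟨1, fun i => i.elim0⟩
  | succ N ih =>
    obtain ⟨w, hw⟩ := ih (fun i => c i.succ) fun i => by
      have := hc i.succ
      simp only [Fin.val_succ] at this
      omega
    have h0 : c 0 < N + 1 := by have := hc 0; simp at this; omega
    set a : Fin (N + 1) := ⟨c 0, h0⟩ with ha
    let g : Fin (N + 1) → Fin (N + 1) := Fin.cons a fun i => a.succAbove (w i)
    have hg : Function.Injective g := by
      refine Fin.cons_injective_iff.mpr ⟨?_, Fin.succAbove_right_injective.comp w.injective⟩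
      rintro ⟨i, hi⟩
      exact Fin.succAbove_ne _ _ hi
    have hg0 : g 0 = a := rfl
    have hgs : ∀ i : Fin N, g i.succ = a.succAbove (w i) := fun _ => rfl
    refine ⟨Equiv.ofBijective g hg.bijective_of_finite, fun i => ?_⟩
    rw [lehmerCode_apply]
    simp only [Equiv.ofBijective_apply]
    refine Fin.cases ?_ (fun i => ?_) i
    · rw [hg0]
      have hcard : c 0 = (Finset.Iio a).card := by simp [ha]
      rw [hcard]
      refine Finset.card_bij (fun j _ => g j) ?_ (fun _ _ _ _ h => hg h) ?_
      · intro j hj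
        simp only [Finset.mem_filter] at hj
        exact Finset.mem_Iio.mpr hj.2.2
      · intro b hb
        obtain ⟨j, rfl⟩ := hg.bijective_of_finite.2 b
        refine ⟨j, ?_, rfl⟩
        simp only [Finset.mem_filter, Finset.mem_univ, true_and]
        refine ⟨Fin.pos_of_ne_zero ?_, Finset.mem_Iio.mp hb⟩
        rintro rfl
        exact (Finset.mem_Iio.mp hb).false
    · rw [← hw i, lehmerCode_apply]
      refine (Finset.card_bij (fun j _ => j.succ) ?_ (fun _ _ _ _ h => Fin.succ_injective _ h)
        ?_).symm
      · intro j hj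
        simpa [hgs, (Fin.strictMono_succAbove a).lt_iff_lt] using hj
      · intro b hb
        simp only [Finset.mem_filter, Finset.mem_univ, true_and] at hb
        obtain ⟨j, rfl⟩ := Fin.exists_succ_eq.mpr (Fin.ne_zero_of_lt hb.1)
        refine ⟨j, ?_, rfl⟩
        simpa [hgs, (Fin.strictMono_succAbove a).lt_iff_lt] using hb

variable {n k r : ℕ}

/-- The exponent of the skip monomial of `S`. -/
noncomputable def skipExponent (S : Finset (Fin n)) : Fin n →₀ ℕ :=
  Finsupp.equivFunOnFinite.symm fun s =>
    if s ∈ S then (s : ℕ) + 1 - (S.filter fun t => t < s).card else 0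

theorem skipExponent_apply (S : Finset (Fin n)) (s : Fin n) :
    skipExponent S s = if s ∈ S then (s : ℕ) + 1 - (S.filter fun t => t < s).card else 0 := rfl

theorem skipMonomial_eq (R : Type*) [CommRing R] (S : Finset (Fin n)) :
    skipMonomial R S = monomial (skipExponent S) 1 := by
  rw [monomial_eq, C_1, one_mul, Finsupp.prod_fintype _ _ (by simp), skipMonomial]
  rw [← Finset.prod_subset (Finset.subset_univ S)]
  · exact Finset.prod_congr rfl fun s hs => by rw [skipExponent_apply, if_pos hs]
  · intro s _ hs
    rw [skipExponent_apply, if_neg hs, pow_zero]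

/-- The exponents of the `(n, k, r)`-good monomials. -/
def goodExponents (n k r : ℕ) : Set (Fin n →₀ ℕ) :=
  {e | (∀ S : Finset (Fin n), S.card + r = n + 1 → ¬ skipExponent S ≤ e) ∧
    ∀ i : Fin n, e i < k + ((i : ℕ) + 1)}

theorem goodMonomials_eq (R : Type*) [CommRing R] [Nontrivial R] (n k r : ℕ) :
    goodMonomials R n k r = (fun e => monomial e 1) '' goodExponents n k r := by
  have key : ∀ e : Fin n →₀ ℕ,
      ((∀ S : Finset (Fin n), S.card + r = n + 1 →
        ¬ skipMonomial R S ∣ (monomial e 1 : MvPolynomial (Fin n) R)) ∧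
      ∀ i : Fin n, ¬ (X i ^ (k + ((i : ℕ) + 1)) : MvPolynomial (Fin n) R) ∣ monomial e 1) ↔
      e ∈ goodExponents n k r := by
    intro e
    simp only [skipMonomial_eq, X_pow_eq_monomial, monomial_one_dvd_monomial_one, goodExponents,
      Set.mem_ofPred_eq, Finsupp.single_le_iff, not_le]
  ext p
  constructor
  · rintro ⟨⟨e, rfl⟩, h⟩
    exact ⟨e, (key e).mp h, rfl⟩
  · rintro ⟨e, he, rfl⟩
    exact ⟨⟨e, rfl⟩, (key e).mpr he⟩

/-- For `s ∈ S` the skip exponent becomes 1 + #{t < s : t ∉ S}, the form in which it is compared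
with Lehmer codes; in particular its subtraction never truncates. -/
theorem card_filter_not_mem_lt (S : Finset (Fin n)) (s : Fin n) :
    (Finset.univ.filter fun t => t < s ∧ t ∉ S).card + (S.filter fun t => t < s).card = s := by
  rw [← Finset.card_union_of_disjoint]
  · conv_rhs => rw [← Fin.card_Iio s]
    congr 1
    ext t
    simp only [Finset.mem_union, Finset.mem_filter, Finset.mem_univ, true_and, Finset.mem_Iio]
    tauto
  · rw [Finset.disjoint_left]
    intro t
    simp only [Finset.mem_filter, Finset.mem_univ, true_and]
    tauto

/-- Suppose the skip exponent of `S` is below the code. By induction on `s ∈ S`, the entry at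
`s.rev` is at least `r`: otherwise the smaller entries to its right are all below `r`, hence sit
among the first `n` positions, at reversed positions `t < s` outside `S`, which are too few. But
only `n - r` of the first `n` entries are at least `r`, fewer than `S.card`. -/
theorem reversedCode_mem_goodExponents (hr : r ≤ n) {π : Equiv.Perm (Fin (n + k))}
    (hπ : π ∈ schubertIndex n k r) : reversedCode π ∈ goodExponents n k r := by
  have hlarge : ∀ j : Fin (n + k), (π j : ℕ) < r → (j : ℕ) < n := by
    intro j hj
    obtain ⟨i, hi, hij⟩ := hπ.2 (π j) hj
    rwa [← π.injective hij]
  constructor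
  · intro S hS hle
    have hval : ∀ s ∈ S, r ≤ (π (Fin.castAdd k s.rev) : ℕ) := by
      intro s
      induction s using WellFoundedLT.induction with
      | _ s ih =>
      intro hs
      by_contra! hlt
      have h1 := hle s
      rw [skipExponent_apply, if_pos hs, reversedCode_apply, lehmerCode_apply] at h1
      have h2 : (Finset.univ.filter fun j => Fin.castAdd k s.rev < j ∧
          π j < π (Fin.castAdd k s.rev)).card ≤
          (Finset.univ.filter fun t => t < s ∧ t ∉ S).card := by
        refine Finset.card_le_card_of_surjOn (fun t => Fin.castAdd k t.rev) ?_
        intro j hj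
        simp only [Finset.coe_filter, Finset.mem_univ, true_and, Set.mem_ofPred_eq] at hj
        have hjn : (j : ℕ) < n := hlarge j (lt_trans (Fin.lt_def.mp hj.2) hlt)
        have hjj : Fin.castAdd k (Fin.rev (Fin.rev ⟨j, hjn⟩ : Fin n)) = j := by simp
        have hts : Fin.rev ⟨j, hjn⟩ < s := by
          have := Fin.lt_def.mp hj.1
          rw [Fin.lt_def]
          simp only [Fin.val_rev, Fin.val_castAdd] at this ⊢
          omega
        refine ⟨Fin.rev ⟨j, hjn⟩, ?_, hjj⟩
        simp only [Finset.coe_filter, Finset.mem_univ, true_and, Set.mem_ofPred_eq]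
        refine ⟨hts, fun htS => ?_⟩
        have := ih _ hts htS
        rw [hjj] at this
        have := Fin.lt_def.mp hj.2
        omega
      have h3 := card_filter_not_mem_lt S s
      omega
    have hA : S.card ≤ (Finset.univ.filter fun i : Fin n => r ≤ (π (Fin.castAdd k i) : ℕ)).card := by
      refine Finset.card_le_card_of_injOn Fin.rev ?_ Fin.rev_injective.injOn
      intro s hs
      simpa using hval s hs
    have hB : r ≤ (Finset.univ.filter fun i : Fin n => ¬ r ≤ (π (Fin.castAdd k i) : ℕ)).card := by
      rcases Nat.eq_zero_or_pos r with h0 | h0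
      · omega
      have : (Finset.univ : Finset (Fin r)).card = r := by simp
      conv_lhs => rw [← this]
      refine Finset.card_le_card_of_surjOn
        (fun i => if h : (π (Fin.castAdd k i) : ℕ) < r then ⟨_, h⟩ else ⟨0, h0⟩) ?_
      intro v _
      have hv := v.2
      obtain ⟨i, hi, hiv⟩ := hπ.2 ⟨v, by omega⟩ hv
      have hc : Fin.castAdd k ⟨i, hi⟩ = i := rfl
      exact ⟨⟨i, hi⟩, by simp [hc, hiv], by simp [hc, hiv]⟩
    have := Finset.card_filter_add_card_filter_not (s := (Finset.univ : Finset (Fin n)))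
      fun i => r ≤ (π (Fin.castAdd k i) : ℕ)
    rw [Finset.card_univ, Fintype.card_fin] at this
    omega
  · intro i
    have := lehmerCode_le π (Fin.castAdd k i.rev)
    rw [reversedCode_apply]
    simp only [Fin.val_castAdd, Fin.val_rev] at this
    omega

/-- Removing the largest element of a set does not change the exponents at the others. -/
theorem exists_skipExponent_le_of_le_card {T : Finset (Fin n)} {m : ℕ} (hm : m ≤ T.card) :
    ∃ S : Finset (Fin n), S.card = m ∧ skipExponent S ≤ skipExponent T := by
  induction T using Finset.induction_on_max with
  | empty => exact ⟨∅, by simp at hm ⊢; omega, le_rfl⟩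
  | insert a T ha ih =>
    have haT : a ∉ T := fun h => (ha a h).false
    rw [Finset.card_insert_of_notMem haT] at hm
    rcases hm.eq_or_lt with rfl | hm
    · exact ⟨insert a T, Finset.card_insert_of_notMem haT, le_rfl⟩
    · obtain ⟨S, hS, hle⟩ := ih (by omega)
      refine ⟨S, hS, hle.trans fun s => ?_⟩
      rw [skipExponent_apply, skipExponent_apply]
      by_cases hs : s ∈ T
      · rw [if_pos hs, if_pos (Finset.mem_insert_of_mem hs), Finset.filter_insert,
          if_neg (ha s hs).not_gt]
      · rw [if_neg hs]; exact Nat.zero_le _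

/-- Padding the reversed exponent by zeros gives a code, whose permutation increases after position
`n`. If a value `v < r` were missing from the first `n` entries, let `T` mark the larger entries
there. For `t ∈ T` the code counts `v` itself and all entries at `u < t` outside `T`, so the code is
at least the skip exponent of `T`. As `T` has at least `n - v` elements, it can be shrunk to a
forbidden set. -/
theorem exists_reversedCode_eq (hr : r ≤ n) {e : Fin n →₀ ℕ} (he : e ∈ goodExponents n k r) :
    ∃ π ∈ schubertIndex n k r, reversedCode π = e := by
  obtain ⟨π, hπ⟩ := exists_lehmerCode_eq
    (Fin.addCases (fun i : Fin n => e i.rev) (fun _ : Fin k => 0)) (by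
      intro i
      refine Fin.addCases (fun i => ?_) (fun i => ?_) i
      · rw [Fin.addCases_left]
        have := he.2 i.rev
        simp only [Fin.val_rev, Fin.val_castAdd] at this ⊢
        omega
      · rw [Fin.addCases_right]; exact Nat.zero_le _)
  have hπe : ∀ i, lehmerCode π (Fin.castAdd k i) = e i.rev := fun i => by
    rw [hπ, Fin.addCases_left]
  refine ⟨π, ⟨?_, ?_⟩, ?_⟩
  · intro i j hij hlt
    by_contra hin
    have hi := i.2
    have h0 := hπ (Fin.natAdd n ⟨i - n, by omega⟩)
    have hi' : Fin.natAdd n ⟨i - n, by omega⟩ = i := Fin.ext (by simp; omega)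
    rw [Fin.addCases_right, hi', lehmerCode_apply, Finset.card_eq_zero,
      Finset.filter_eq_empty_iff] at h0
    exact h0 (Finset.mem_univ j) ⟨by rw [Fin.lt_def]; omega, hlt⟩
  · intro v hv
    by_contra! hno
    set T : Finset (Fin n) := Finset.univ.filter fun t => v < π (Fin.castAdd k t.rev) with hT
    have hcard : n - v ≤ T.card := by
      have h1 : (Finset.univ.filter fun t : Fin n => ¬ v < π (Fin.castAdd k t.rev)).card ≤
          (Finset.Iio v).card := by
        refine Finset.card_le_card_of_injOn (fun t => π (Fin.castAdd k t.rev)) ?_ ?_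
        · intro t ht
          simp only [Finset.coe_filter, Finset.mem_univ, true_and, Set.mem_ofPred_eq,
            not_lt] at ht
          have := hno (Fin.castAdd k t.rev) (by simp; omega)
          simpa using lt_of_le_of_ne ht this
        · intro t _ t' _ h
          exact Fin.rev_injective (Fin.castAdd_injective _ _ (π.injective h))
      have h2 := Finset.card_filter_add_card_filter_not (s := (Finset.univ : Finset (Fin n)))
        fun t => v < π (Fin.castAdd k t.rev)
      rw [Finset.card_univ, Fintype.card_fin] at h2
      rw [Fin.card_Iio] at h1
      rw [← hT] at h2
      omega
    obtain ⟨S, hS, hle⟩ := exists_skipExponent_le_of_le_card (T := T) (m := n + 1 - r) (by omega)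
    refine he.1 S (by omega) (hle.trans fun t => ?_)
    rw [skipExponent_apply]
    split_ifs with ht
    swap
    · exact Nat.zero_le _
    have het : e t = lehmerCode π (Fin.castAdd k t.rev) := by rw [hπe, Fin.rev_rev]
    obtain ⟨p, hp⟩ := π.surjective v
    have hpn : n ≤ (p : ℕ) := by
      by_contra! hpn
      exact hno p hpn hp
    have htv : v < π (Fin.castAdd k t.rev) := by simpa [hT] using ht
    have h1 : (insert p ((Finset.univ.filter fun u => u < t ∧ u ∉ T).image
        fun u => Fin.castAdd k u.rev)).card ≤ lehmerCode π (Fin.castAdd k t.rev) := by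
      rw [lehmerCode_apply]
      refine Finset.card_le_card fun j hj => ?_
      simp only [Finset.mem_filter, Finset.mem_univ, true_and, Finset.mem_insert,
        Finset.mem_image] at hj ⊢
      rcases hj with rfl | ⟨u, ⟨hu, huT⟩, rfl⟩
      · rw [hp]
        refine ⟨?_, htv⟩
        rw [Fin.lt_def]
        simp only [Fin.val_castAdd, Fin.val_rev]
        omega
      · refine ⟨?_, lt_of_le_of_lt ?_ htv⟩
        · rw [Fin.lt_def] at hu ⊢
          simp only [Fin.val_castAdd, Fin.val_rev]
          omega
        · simpa [hT] using huT
    rw [Finset.card_insert_of_notMem, Finset.card_image_of_injective] at h1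
    · have := card_filter_not_mem_lt T t
      omega
    · exact fun u u' h => Fin.rev_injective (Fin.castAdd_injective _ _ h)
    · intro hmem
      obtain ⟨u, -, hu⟩ := Finset.mem_image.mp hmem
      have := congrArg Fin.val hu
      simp only [Fin.val_castAdd, Fin.val_rev] at this
      omega
  · ext i
    rw [reversedCode_apply, hπe, Fin.rev_rev]

theorem image_reversedCode (hr : r ≤ n) :
    reversedCode '' schubertIndex n k r = goodExponents n k r := by
  ext e
  constructor
  · rintro ⟨π, hπ, rfl⟩
    exact reversedCode_mem_goodExponents hr hπ
  · exact fun he => exists_reversedCode_eq hr he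

end Codes

/-! ### Generating functions of complete and elementary symmetric polynomials. -/

section GeneratingFunctions

variable {σ A : Type*} [CommRing A]

/-- The generating function `∏_{i ∈ s} 1 / (1 - x_i t)` of the complete homogeneous symmetric
polynomials in the `x_i`, `i ∈ s`. -/
noncomputable def completeSeries (x : σ → A) (s : Finset σ) : PowerSeries A :=
  ∏ i ∈ s, PowerSeries.mk fun n => x i ^ n

/-- The generating function `∏_{i ∈ s} (1 - x_i t)` of the signed elementary symmetric
polynomials in the `x_i`, `i ∈ s`. -/
noncomputable def elementarySeries (x : σ → A) (s : Finset σ) : PowerSeries A :=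
  ∏ i ∈ s, (1 - PowerSeries.C (x i) * PowerSeries.X)

theorem completeSeries_mul_elementarySeries (x : σ → A) (s : Finset σ) :
    completeSeries x s * elementarySeries x s = 1 := by
  rw [completeSeries, elementarySeries, ← Finset.prod_mul_distrib]
  refine Finset.prod_eq_one fun i _ => ?_
  ext m
  rw [mul_sub, mul_one, map_sub, mul_comm (PowerSeries.C (x i)), ← mul_assoc]
  cases m with
  | zero => simp
  | succ m =>
    rw [PowerSeries.coeff_mul_C, PowerSeries.coeff_succ_mul_X]
    simp [pow_succ, PowerSeries.coeff_one]

theorem coeff_elementarySeries [DecidableEq σ] (x : σ → A) (s : Finset σ) (d : ℕ) :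
    PowerSeries.coeff d (elementarySeries x s) =
      (-1) ^ d * ∑ t ∈ s.powersetCard d, ∏ i ∈ t, x i := by
  have h : ∀ t : Finset σ, ∏ i ∈ t, -(PowerSeries.C (x i) * PowerSeries.X) =
      PowerSeries.C ((-1) ^ t.card * ∏ i ∈ t, x i) * PowerSeries.X ^ t.card := by
    intro t
    rw [Finset.prod_neg, Finset.prod_mul_distrib, Finset.prod_const, map_mul, map_prod, map_pow,
      map_neg, map_one, mul_assoc]
  simp only [elementarySeries, sub_eq_add_neg]
  rw [Finset.prod_one_add, map_sum, Finset.mul_sum]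
  simp only [h, PowerSeries.coeff_C_mul, PowerSeries.coeff_X_pow, mul_ite, mul_one, mul_zero]
  rw [← Finset.sum_filter]
  refine Finset.sum_congr ?_ fun t ht => ?_
  · ext t
    simp only [Finset.mem_filter, Finset.mem_powerset, Finset.mem_powersetCard, eq_comm]
  · rw [(Finset.mem_powersetCard.mp ht).2]

theorem coeff_elementarySeries_eq_zero (x : σ → A) (s : Finset σ) {d : ℕ}
    (hd : s.card < d) : PowerSeries.coeff d (elementarySeries x s) = 0 := by
  classical
  rw [coeff_elementarySeries, Finset.powersetCard_eq_empty.mpr hd, Finset.sum_empty, mul_zero]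

theorem coeff_elementarySeries_univ {F : Type*} [CommRing F] [Algebra F A] [Fintype σ]
    (x : σ → A) (d : ℕ) :
    PowerSeries.coeff d (elementarySeries x Finset.univ) = (-1) ^ d * aeval x (esymm σ F d) := by
  classical
  rw [coeff_elementarySeries, esymm, map_sum]
  simp only [map_prod, aeval_X]

theorem coeff_completeSeries [DecidableEq σ] (x : σ → A) (s : Finset σ) (d : ℕ) :
    PowerSeries.coeff d (completeSeries x s) =
      ∑ l ∈ s.finsuppAntidiag d, ∏ i ∈ s, x i ^ l i := by
  simp only [completeSeries, PowerSeries.coeff_prod, PowerSeries.coeff_mk]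

theorem coeff_completeSeries_univ {F : Type*} [CommRing F] [Algebra F A] [Fintype σ]
    [DecidableEq σ] (x : σ → A) (d : ℕ) :
    PowerSeries.coeff d (completeSeries x Finset.univ) = aeval x (hsymm σ F d) := by
  rw [coeff_completeSeries, hsymm, map_sum]
  symm
  refine Finset.sum_bij (fun s _ => Multiset.toFinsupp s.1) ?_ ?_ ?_ ?_
  · intro s _
    rw [Finset.mem_finsuppAntidiag]
    refine ⟨?_, Finset.subset_univ _⟩
    have := Multiset.toFinsupp_sum_eq s.1
    rw [Finsupp.sum_fintype _ _ (by simp), s.2] at this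
    exact this
  · intro s _ s' _ h
    exact Subtype.ext (Multiset.toFinsupp.injective h)
  · intro l hl
    rw [Finset.mem_finsuppAntidiag] at hl
    refine ⟨⟨Finsupp.toMultiset l, ?_⟩, Finset.mem_univ _, by simp⟩
    rw [Finsupp.card_toMultiset, Finsupp.sum_fintype _ _ (by simp)]
    exact hl.1
  · intro s _
    rw [map_multiset_prod, Multiset.map_map]
    simp only [Function.comp_def, aeval_X]
    rw [Finset.prod_multiset_map_count]
    refine Finset.prod_subset (Finset.subset_univ _) fun i _ hi => ?_
    rw [Multiset.mem_toFinset] at hi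
    rw [Multiset.count_eq_zero_of_notMem hi, pow_zero]

theorem elementarySeries_sdiff [DecidableEq σ] (x : σ → A) {s t : Finset σ} (h : s ⊆ t) :
    elementarySeries x (t \ s) = completeSeries x s * elementarySeries x t := by
  have h1 := completeSeries_mul_elementarySeries x s
  have h2 : elementarySeries x (t \ s) * elementarySeries x s = elementarySeries x t :=
    Finset.prod_sdiff h
  rw [← h2, mul_left_comm, h1, mul_one]

theorem completeSeries_eq_mul [DecidableEq σ] (x : σ → A) {s t : Finset σ} (h : s ⊆ t) :
    completeSeries x s = completeSeries x t * elementarySeries x (t \ s) := by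
  rw [elementarySeries_sdiff x h, mul_left_comm, completeSeries_mul_elementarySeries, mul_one]

end GeneratingFunctions

/-! ### Elements of the ideal with prescribed leading monomials. -/

section LeadingMonomials

variable {F : Type*} [Field F] {n k r : ℕ}

theorem coeff_completeSeries_X (s : Finset (Fin n)) (d : ℕ) :
    PowerSeries.coeff d (completeSeries (X : Fin n → MvPolynomial (Fin n) F) s) =
      ∑ l ∈ s.finsuppAntidiag d, monomial l 1 := by
  rw [coeff_completeSeries]
  refine Finset.sum_congr rfl fun l hl => ?_
  rw [monomial_eq, C_1, one_mul]
  exact (Finsupp.prod_of_support_subset _ (Finset.mem_finsuppAntidiag.mp hl).2 _ (by simp)).symm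

theorem degree_coeff_completeSeries_Ici (s : Fin n) (d : ℕ) :
    MonomialOrder.lex.degree (PowerSeries.coeff d
      (completeSeries (X : Fin n → MvPolynomial (Fin n) F) (Finset.Ici s))) = Finsupp.single s d ∧
    MonomialOrder.lex.Monic (PowerSeries.coeff d
      (completeSeries (X : Fin n → MvPolynomial (Fin n) F) (Finset.Ici s))) := by
  have hmem : Finsupp.single s d ∈ (Finset.Ici s).finsuppAntidiag d := by
    rw [Finset.mem_finsuppAntidiag]
    refine ⟨?_, Finsupp.support_single_subset.trans (by simp)⟩
    rw [Finset.sum_eq_single_of_mem s (by simp) fun b _ hb => by simp [hb.symm]]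
    simp
  rw [coeff_completeSeries_X]
  apply degree_eq_of_coeff_of_lt
  · rw [coeff_sum, Finset.sum_eq_single_of_mem _ hmem]
    · simp
    · intro l _ hl
      rw [coeff_monomial, if_neg hl]
  · intro l hl hne
    obtain ⟨l', hl', hl⟩ := Finset.mem_biUnion.mp (support_sum hl)
    have := Finset.mem_singleton.mp (support_monomial_subset hl)
    subst this
    obtain ⟨h1, h2⟩ := Finset.mem_finsuppAntidiag.mp hl'
    change ∑ j ∈ Finset.Ici s, l j = d at h1
    have h0 : ∀ j < s, l j = 0 := fun j hj => by
      by_contra h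
      exact hj.not_ge (Finset.mem_Ici.mp (h2 (Finsupp.mem_support_iff.mpr h)))
    refine lex_lt_of_forall_lt s ?_ fun j hj => by rw [h0 j hj, Finsupp.single_eq_of_ne hj.ne]
    rw [Finsupp.single_eq_same]
    by_contra! hge
    apply hne
    have hs := Finset.add_sum_erase (Finset.Ici s) l (by simp : s ∈ Finset.Ici s)
    have hz : ∑ j ∈ (Finset.Ici s).erase s, l j = 0 := by omega
    ext j
    by_cases hj : j = s
    · subst hj; simp; omega
    · rw [Finsupp.single_eq_of_ne hj]
      rcases lt_or_gt_of_ne hj with hj' | hj'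
      · exact h0 j hj'
      · exact Finset.sum_eq_zero_iff.mp hz j
          (Finset.mem_erase.mpr ⟨hj, Finset.mem_Ici.mpr hj'.le⟩)

theorem hsymm_mem_idealI {d : ℕ} (h1 : k + 1 ≤ d) (h2 : d ≤ k + n) :
    hsymm (Fin n) F d ∈ idealI F n k r :=
  Ideal.subset_span (Or.inl ⟨d, h1, h2, rfl⟩)

theorem esymm_mem_idealI {d : ℕ} (h1 : n + 1 ≤ d + r) (h2 : d ≤ n) :
    esymm (Fin n) F d ∈ idealI F n k r :=
  Ideal.subset_span (Or.inr ⟨d, h1, h2, rfl⟩)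

/-- The series of the variables from `i` on is the full complete series times a polynomial of degree
at most `i`, so only h_d with k + 1 ≤ d ≤ k + i + 1 contribute. -/
theorem coeff_completeSeries_Ici_mem_idealI (i : Fin n) :
    PowerSeries.coeff (k + (i + 1))
      (completeSeries (X : Fin n → MvPolynomial (Fin n) F) (Finset.Ici i)) ∈ idealI F n k r := by
  rw [completeSeries_eq_mul X (Finset.subset_univ _), PowerSeries.coeff_mul]
  refine Ideal.sum_mem _ fun p hp => ?_
  have hp := Finset.HasAntidiagonal.mem_antidiagonal.mp hp
  have hi := i.2
  have hcard : (Finset.univ \ Finset.Ici i).card = i := by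
    rw [Finset.card_univ_sdiff, Fin.card_Ici, Fintype.card_fin]; omega
  by_cases h : p.2 ≤ i
  · refine Ideal.mul_mem_right _ _ ?_
    rw [coeff_completeSeries_univ (F := F), aeval_X_left_apply]
    exact hsymm_mem_idealI (by omega) (by omega)
  · rw [coeff_elementarySeries_eq_zero _ _ (by omega), mul_zero]
    exact Ideal.zero_mem _

/-- The matrix of the `h_(s_i + 1 - j)` in the variables with index at least `s_i`. For
`s_0 < s_1 < ⋯` its determinant has the skip monomial of the `s_i` as leading monomial. -/
noncomputable def flaggedMatrix (F : Type*) [Field F] {n m : ℕ} (s : Fin m → Fin n) :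
    Matrix (Fin m) (Fin m) (MvPolynomial (Fin n) F) :=
  Matrix.of fun i j => PowerSeries.coeff (s i + 1)
    (PowerSeries.X ^ (j : ℕ) * completeSeries X (Finset.Ici (s i)))

theorem flaggedMatrix_apply {m : ℕ} (s : Fin m → Fin n) (i j : Fin m) :
    flaggedMatrix F s i j = if (j : ℕ) ≤ s i + 1 then
      PowerSeries.coeff (s i + 1 - j) (completeSeries X (Finset.Ici (s i))) else 0 := by
  rw [flaggedMatrix, Matrix.of_apply, PowerSeries.coeff_X_pow_mul']

/-- The ring may have zero divisors; the adjugate gives `det • v = 0`, and the coordinate equal to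
`1` isolates the determinant. -/
theorem det_eq_zero_of_mulVec_eq_zero {A : Type*} [CommRing A] {m : ℕ}
    (M : Matrix (Fin (m + 1)) (Fin (m + 1)) A) (v : Fin (m + 1) → A) (h0 : v 0 = 1)
    (h : M.mulVec v = 0) : M.det = 0 := by
  have : (M.det • (1 : Matrix (Fin (m + 1)) (Fin (m + 1)) A)).mulVec v = 0 := by
    rw [← Matrix.adjugate_mul, ← Matrix.mulVec_mulVec, h, Matrix.mulVec_zero]
  have := congrFun this 0
  simpa [Matrix.smul_mulVec, h0] using this

/-- The complete series from `s i` on times the full elementary series is a polynomial of degree at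
most `s i`, so its coefficient at `s i + 1` vanishes. Modulo the ideal the e_j with j > m vanish
too, and what remains says that the matrix kills the vector of signed e_0, …, e_m, where e_0 = 1. -/
theorem det_flaggedMatrix_mem_idealI {m : ℕ} (hm : m + 1 + r = n + 1)
    (s : Fin (m + 1) → Fin n) : (flaggedMatrix F s).det ∈ idealI F n k r := by
  rw [← Ideal.Quotient.eq_zero_iff_mem, RingHom.map_det]
  set q := Ideal.Quotient.mk (idealI F n k r)
  set e : PowerSeries (MvPolynomial (Fin n) F) := elementarySeries X Finset.univ with he
  refine det_eq_zero_of_mulVec_eq_zero _ (fun j => q (PowerSeries.coeff j e)) ?_ ?_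
  · rw [he, coeff_elementarySeries]; simp
  · ext i
    have hz : PowerSeries.coeff (s i + 1) (completeSeries X (Finset.Ici (s i)) * e) = 0 := by
      rw [he, ← elementarySeries_sdiff X (Finset.subset_univ _)]
      apply coeff_elementarySeries_eq_zero
      rw [Finset.card_univ_sdiff, Fin.card_Ici, Fintype.card_fin]
      omega
    -- The range is longer than necessary, so that the first `m + 1` terms can be split off whatever
    -- the size of `s i`; the added terms are zero.
    have hsum : PowerSeries.coeff (s i + 1) (completeSeries X (Finset.Ici (s i)) * e) =
        ∑ j ∈ Finset.range (s i + 1 + 1 + (m + 1)), PowerSeries.coeff (s i + 1)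
          (PowerSeries.X ^ j * completeSeries X (Finset.Ici (s i))) * PowerSeries.coeff j e := by
      rw [mul_comm, PowerSeries.coeff_mul, Finset.Nat.sum_antidiagonal_eq_sum_range_succ_mk]
      refine Finset.sum_subset_zero_on_sdiff (by simp) ?_ ?_
      · intro j hj
        simp only [Finset.mem_sdiff, Finset.mem_range] at hj
        rw [PowerSeries.coeff_X_pow_mul', if_neg (by omega), zero_mul]
      · intro j hj
        rw [Finset.mem_range] at hj
        rw [PowerSeries.coeff_X_pow_mul', if_pos (by omega), mul_comm]
    rw [hsum] at hz
    have hq := congrArg q hz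
    rw [map_sum, map_zero, add_comm _ (m + 1), Finset.sum_range_add, Finset.sum_eq_zero (s :=
      Finset.range (s i + 1 + 1)), add_zero, ← Fin.sum_univ_eq_sum_range] at hq
    · simpa [Matrix.mulVec, dotProduct, flaggedMatrix] using hq
    · intro j _
      rw [map_mul]
      refine mul_eq_zero_of_right _ ?_
      rw [Ideal.Quotient.eq_zero_iff_mem]
      by_cases hj : m + 1 + j ≤ n
      · rw [he, coeff_elementarySeries_univ (F := F), aeval_X_left_apply]
        exact Ideal.mul_mem_left _ _ (esymm_mem_idealI (by omega) hj)
      · rw [he, coeff_elementarySeries_eq_zero _ _ (by simp; omega)]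
        exact Ideal.zero_mem _

theorem skipExponent_orderEmbOfFin {m : ℕ} (S : Finset (Fin n)) (hS : S.card = m) :
    skipExponent S = ∑ i : Fin m,
      Finsupp.single (S.orderEmbOfFin hS i) ((S.orderEmbOfFin hS i : ℕ) + 1 - i) := by
  ext t
  rw [skipExponent_apply, Finsupp.finsetSum_apply]
  split_ifs with ht
  · obtain ⟨i, rfl⟩ : t ∈ Set.range (S.orderEmbOfFin hS) := by
      rwa [Finset.range_orderEmbOfFin]
    have hcard : S.filter (fun t => t < S.orderEmbOfFin hS i) =
        (Finset.Iio i).map (S.orderEmbOfFin hS).toEmbedding := by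
      ext t
      simp only [Finset.mem_filter, Finset.mem_map, Finset.mem_Iio]
      constructor
      · rintro ⟨ht, hlt⟩
        obtain ⟨j, rfl⟩ : t ∈ Set.range (S.orderEmbOfFin hS) := by
          rwa [Finset.range_orderEmbOfFin]
        exact ⟨j, (S.orderEmbOfFin hS).lt_iff_lt.mp hlt, rfl⟩
      · rintro ⟨j, hj, rfl⟩
        exact ⟨Finset.orderEmbOfFin_mem _ _ _, (S.orderEmbOfFin hS).lt_iff_lt.mpr hj⟩
    rw [hcard, Finset.card_map, Fin.card_Iio, Finset.sum_eq_single_of_mem i (Finset.mem_univ i),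
      Finsupp.single_eq_same]
    intro j _ hj
    exact Finsupp.single_eq_of_ne fun h => hj ((S.orderEmbOfFin hS).injective h.symm)
  · refine (Finset.sum_eq_zero fun i _ => Finsupp.single_eq_of_ne ?_).symm
    rintro rfl
    exact ht (Finset.orderEmbOfFin_mem _ _ _)

/-- The first index `i₀` moved by `σ` is moved up, which lowers the exponent of the variable `s i₀`,
while the variables before it keep theirs. -/
theorem degree_prod_flaggedMatrix_lt {m : ℕ} (s : Fin m ↪o Fin n) {σ : Equiv.Perm (Fin m)}
    (hσ : σ ≠ 1) {e : Fin n →₀ ℕ} (he : e ∈ (∏ i, flaggedMatrix F s i (σ i)).support) :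
    MonomialOrder.lex.toSyn e <
      MonomialOrder.lex.toSyn (∑ i, Finsupp.single (s i) ((s i : ℕ) + 1 - i)) := by
  -- Otherwise the product has a zero factor; this keeps `s i + 1 - σ i` from truncating.
  have hσs : ∀ i, (σ i : ℕ) ≤ s i + 1 := by
    by_contra! h
    obtain ⟨i, hi⟩ := h
    rw [Finset.prod_eq_zero (Finset.mem_univ i)
      (by rw [flaggedMatrix_apply, if_neg (by omega)])] at he
    simp at he
  have hdeg : ∀ i, MonomialOrder.lex.degree (flaggedMatrix F s i (σ i)) =
      Finsupp.single (s i) ((s i : ℕ) + 1 - σ i) := fun i => by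
    rw [flaggedMatrix_apply, if_pos (hσs i), (degree_coeff_completeSeries_Ici _ _).1]
  refine (MonomialOrder.lex.le_degree he).trans_lt ((MonomialOrder.degree_prod_le).trans_lt ?_)
  simp only [hdeg]
  obtain ⟨i₀, hi₀, hmin⟩ : ∃ i, σ i ≠ i ∧ ∀ j < i, σ j = j := by
    have hne : ∃ i, σ i ≠ i := by
      by_contra! h
      exact hσ (Equiv.ext h)
    obtain ⟨i, hi, hi'⟩ := WellFounded.has_min wellFounded_lt {i | σ i ≠ i} hne
    exact ⟨i, hi, fun j hj => by_contra fun h => hi' j h hj⟩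
  have hgt : ∀ i, i ≤ i₀ → i ≤ σ i := by
    intro i hi
    rcases hi.eq_or_lt with rfl | hi
    · by_contra! h
      exact hi₀ (σ.injective (hmin _ h))
    · exact (hmin i hi).ge
  refine lex_lt_of_forall_lt (s i₀) ?_ fun l hl => ?_
  · rw [Finsupp.finsetSum_apply, Finsupp.finsetSum_apply]
    refine Finset.sum_lt_sum (fun i _ => ?_) ⟨i₀, Finset.mem_univ _, ?_⟩
    · by_cases hi : i = i₀
      · subst hi
        rw [Finsupp.single_eq_same, Finsupp.single_eq_same]
        have := Fin.le_def.mp (hgt i le_rfl)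
        omega
      · rw [Finsupp.single_eq_of_ne fun h => hi (s.injective h.symm)]
        exact Nat.zero_le _
    · rw [Finsupp.single_eq_same, Finsupp.single_eq_same]
      have h1 := Fin.lt_def.mp (lt_of_le_of_ne (hgt i₀ le_rfl) hi₀.symm)
      have h2 := hσs i₀
      omega
  · rw [Finsupp.finsetSum_apply, Finsupp.finsetSum_apply]
    refine Finset.sum_congr rfl fun i _ => ?_
    by_cases hi : l = s i
    · subst hi
      rw [hmin i (s.lt_iff_lt.mp hl)]
    · rw [Finsupp.single_eq_of_ne hi, Finsupp.single_eq_of_ne hi]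

theorem degree_det_flaggedMatrix {m : ℕ} (s : Fin m ↪o Fin n) :
    MonomialOrder.lex.degree (flaggedMatrix F s).det =
      ∑ i, Finsupp.single (s i) ((s i : ℕ) + 1 - i) ∧
    MonomialOrder.lex.Monic (flaggedMatrix F s).det := by
  have hle : ∀ i : Fin m, (i : ℕ) ≤ s i := fun i => by
    have h1 : ((Finset.Iio i).map s.toEmbedding).card ≤ (Finset.Iio (s i)).card :=
      Finset.card_le_card fun t ht => by
        obtain ⟨j, hj, rfl⟩ := Finset.mem_map.mp ht
        exact Finset.mem_Iio.mpr (s.lt_iff_lt.mpr (Finset.mem_Iio.mp hj))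
    simpa using h1
  have hentry : ∀ i, flaggedMatrix F s i i =
      PowerSeries.coeff (s i + 1 - i) (completeSeries X (Finset.Ici (s i))) := fun i => by
    rw [flaggedMatrix_apply, if_pos ((hle i).trans (Nat.le_succ _))]
  have hmonic : ∀ i, MonomialOrder.lex.Monic (flaggedMatrix F s i i) := fun i => by
    rw [hentry]; exact (degree_coeff_completeSeries_Ici _ _).2
  have hprod : MonomialOrder.lex.Monic (∏ i, flaggedMatrix F s i i) :=
    MonomialOrder.Monic.prod fun i _ => hmonic i
  have hdeg : MonomialOrder.lex.degree (∏ i, flaggedMatrix F s i i) =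
      ∑ i, Finsupp.single (s i) ((s i : ℕ) + 1 - i) := by
    rw [MonomialOrder.degree_prod fun i _ => (hmonic i).ne_zero]
    refine Finset.sum_congr rfl fun i _ => ?_
    rw [hentry, (degree_coeff_completeSeries_Ici _ _).1]
  have hdet : (flaggedMatrix F s).det =
      ∑ σ : Equiv.Perm (Fin m), Equiv.Perm.sign σ • ∏ i, flaggedMatrix F s i (σ i) := by
    rw [← Matrix.det_transpose, Matrix.det_apply]
    rfl
  have hsupp : ∀ σ : Equiv.Perm (Fin m), ∀ e,
      e ∈ (Equiv.Perm.sign σ • ∏ i, flaggedMatrix F s i (σ i)).support →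
      e ∈ (∏ i, flaggedMatrix F s i (σ i)).support := by
    intro σ e he
    rcases Int.units_eq_one_or (Equiv.Perm.sign σ) with h | h <;> simpa [h] using he
  apply degree_eq_of_coeff_of_lt
  · rw [hdet, coeff_sum, Finset.sum_eq_single_of_mem 1 (Finset.mem_univ 1)]
    · rw [← hdeg]
      simpa using hprod.coeff_degree
    · intro σ _ hσ
      by_contra h
      exact (degree_prod_flaggedMatrix_lt s hσ (hsupp σ _ (mem_support_iff.mpr h))).false
  · intro e he hne
    rw [hdet] at he
    obtain ⟨σ, _, he⟩ := Finset.mem_biUnion.mp (support_sum he)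
    by_cases hσ : σ = 1
    · subst hσ
      have := MonomialOrder.lex.le_degree (hsupp 1 e he)
      simp only [Equiv.Perm.one_apply, hdeg] at this
      exact lt_of_le_of_ne this fun h => hne (MonomialOrder.lex.toSyn.injective h)
    · exact degree_prod_flaggedMatrix_lt s hσ (hsupp σ e he)

theorem exists_mem_idealI_of_not_mem_goodExponents (hr : r ≤ n) {e : Fin n →₀ ℕ}
    (he : e ∉ goodExponents n k r) : ∃ f ∈ idealI F n k r,
      MonomialOrder.lex.degree f = e ∧ MonomialOrder.lex.Monic f := by
  suffices ∃ c ≤ e, ∃ f ∈ idealI F n k r,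
      MonomialOrder.lex.degree f = c ∧ MonomialOrder.lex.Monic f by
    obtain ⟨c, hc, f, hf, hfc, hfm⟩ := this
    have hmon : MonomialOrder.lex.Monic (monomial (e - c) (1 : F)) :=
      MonomialOrder.monic_monomial_one
    refine ⟨monomial (e - c) 1 * f, Ideal.mul_mem_left _ _ hf, ?_, hmon.mul hfm⟩
    classical
    rw [MonomialOrder.degree_mul hmon.ne_zero hfm.ne_zero, hfc, MonomialOrder.degree_monomial,
      if_neg one_ne_zero, tsub_add_cancel_of_le hc]
  simp only [goodExponents, Set.mem_ofPred_eq, not_and_or, not_forall, not_not, not_lt] at he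
  rcases he with ⟨S, hS, hle⟩ | ⟨i, hi⟩
  · obtain ⟨m, hm⟩ : ∃ m, S.card = m + 1 := ⟨S.card - 1, by omega⟩
    refine ⟨_, hle, _, det_flaggedMatrix_mem_idealI (m := m) (by omega) (S.orderEmbOfFin hm), ?_⟩
    rw [skipExponent_orderEmbOfFin S hm]
    exact degree_det_flaggedMatrix (S.orderEmbOfFin hm)
  · exact ⟨_, Finsupp.single_le_iff.mpr hi, _, coeff_completeSeries_Ici_mem_idealI i,
      degree_coeff_completeSeries_Ici _ _⟩

/-- A subspace is everything if every monomial is the leading monomial of one of its elements. -/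
theorem submodule_eq_top_of_forall_exists_degree {σ : Type*} (m : MonomialOrder σ)
    (V : Submodule F (MvPolynomial σ F))
    (hV : ∀ e, ∃ f ∈ V, m.degree f = e ∧ m.Monic f) : V = ⊤ := by
  have key : ∀ e : m.syn, ∀ p : MvPolynomial σ F, m.toSyn (m.degree p) = e → p ∈ V := by
    intro e
    induction e using WellFoundedLT.induction with
    | _ e ih =>
    intro p hp
    obtain ⟨f, hf, hfd, hfm⟩ := hV (m.degree p)
    have hq : p - m.leadingCoeff p • f ∈ V := by
      by_cases h0 : p - m.leadingCoeff p • f = 0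
      · rw [h0]; exact V.zero_mem
      refine ih _ ?_ _ rfl
      rw [← hp]
      refine lt_of_le_of_ne ?_ fun h => ?_
      · refine m.degree_sub_le.trans (sup_le le_rfl ?_)
        refine m.degree_smul_le.trans ?_
        rw [hfd]
      · have hd := m.toSyn.injective h
        have hc := (m.coeff_degree_ne_zero_iff (f := p - m.leadingCoeff p • f)).mpr h0
        rw [hd, coeff_sub, coeff_smul, ← hfd, hfm.coeff_degree, hfd] at hc
        simp [MonomialOrder.leadingCoeff] at hc
    have := V.add_mem hq (V.smul_mem (m.leadingCoeff p) hf)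
    rwa [sub_add_cancel] at this
  exact eq_top_iff.mpr fun p _ => key _ p rfl

end LeadingMonomials

/-! ### Top degree parts and ideals of finite point sets. -/

section TopDegree

variable {σ K : Type*} [Field K]

/-- The polynomials of degree less than `D`; for `D = 0` only the zero polynomial. -/
noncomputable def lowDegree (σ K : Type*) [Field K] (D : ℕ) : Submodule K (MvPolynomial σ K) :=
  restrictSupport K {e | e.degree < D}

theorem mem_lowDegree {D : ℕ} {p : MvPolynomial σ K} :
    p ∈ lowDegree σ K D ↔ ∀ e, coeff e p ≠ 0 → e.degree < D := by
  rw [lowDegree, mem_restrictSupport_iff]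
  exact ⟨fun h e he => h (mem_support_iff.mpr he), fun h e he => h e (mem_support_iff.mp he)⟩

theorem MvPolynomial.IsHomogeneous.mem_lowDegree {D d : ℕ} {p : MvPolynomial σ K}
    (hp : p.IsHomogeneous d) (hd : d < D) : p ∈ lowDegree σ K D := by
  rw [_root_.mem_lowDegree]
  intro e he
  by_contra! h
  exact he (hp.coeff_eq_zero (by omega))

theorem sub_homogeneousComponent_mem_lowDegree {D : ℕ} {p : MvPolynomial σ K}
    (hp : p ∈ lowDegree σ K (D + 1)) : p - homogeneousComponent D p ∈ lowDegree σ K D := by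
  rw [mem_lowDegree] at hp ⊢
  intro e he
  rw [coeff_sub, coeff_homogeneousComponent] at he
  split_ifs at he with h
  · simp at he
  · rw [sub_zero] at he
    have := hp e he
    omega

theorem homogeneousComponent_succ_mul_X (D : ℕ) (p : MvPolynomial σ K) (i : σ) :
    homogeneousComponent (D + 1) (p * X i) = homogeneousComponent D p * X i := by
  classical
  ext e
  rw [coeff_homogeneousComponent, coeff_mul_X', coeff_mul_X', coeff_homogeneousComponent]
  by_cases he : i ∈ e.support
  · rw [if_pos he, if_pos he]
    have h1 : Finsupp.single i 1 ≤ e := by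
      rw [Finsupp.single_le_iff]
      exact Nat.one_le_iff_ne_zero.mpr (Finsupp.mem_support_iff.mp he)
    have h2 : (e - Finsupp.single i 1).degree + 1 = e.degree := by
      conv_rhs => rw [← tsub_add_cancel_of_le h1]
      rw [map_add, Finsupp.degree_single]
    have h3 : e.degree = D + 1 ↔ (e - Finsupp.single i 1).degree = D := by omega
    simp only [h3]
  · rw [if_neg he, if_neg he]; simp

theorem mul_X_mem_lowDegree {D : ℕ} {p : MvPolynomial σ K} (hp : p ∈ lowDegree σ K D) (i : σ) :
    p * X i ∈ lowDegree σ K (D + 1) := by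
  classical
  rw [mem_lowDegree] at hp ⊢
  intro e he
  rw [coeff_mul_X'] at he
  split_ifs at he with h
  · have := hp _ he
    have h1 : Finsupp.single i 1 ≤ e := by
      rw [Finsupp.single_le_iff]
      exact Nat.one_le_iff_ne_zero.mpr (Finsupp.mem_support_iff.mp h)
    have h2 : (e - Finsupp.single i 1).degree + 1 = e.degree := by
      conv_rhs => rw [← tsub_add_cancel_of_le h1]
      rw [map_add, Finsupp.degree_single]
    omega
  · exact absurd rfl he

/-- If the homogeneous generators of an ideal are top degree parts of elements of `J`, so are
all homogeneous components of its elements. -/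
theorem exists_mem_sub_homogeneousComponent_mem_lowDegree {G : Set (MvPolynomial σ K)}
    {J : Ideal (MvPolynomial σ K)}
    (hG : ∀ g ∈ G, ∃ d, g.IsHomogeneous d ∧ ∃ g' ∈ J, g' - g ∈ lowDegree σ K d)
    {f : MvPolynomial σ K} (hf : f ∈ Ideal.span G) (D : ℕ) :
    ∃ f' ∈ J, f' - homogeneousComponent D f ∈ lowDegree σ K D := by
  induction hf using Submodule.span_induction generalizing D with
  | mem g hg =>
    obtain ⟨d, hd, g', hg', hlow⟩ := hG g hg
    rw [homogeneousComponent_of_mem ((mem_homogeneousSubmodule _ _).mpr hd)]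
    split_ifs with h
    · subst h; exact ⟨g', hg', hlow⟩
    · exact ⟨0, J.zero_mem, by simp⟩
  | zero => exact ⟨0, J.zero_mem, by simp⟩
  | add f g _ _ hf hg =>
    obtain ⟨f', hf', hf⟩ := hf D
    obtain ⟨g', hg', hg⟩ := hg D
    refine ⟨f' + g', J.add_mem hf' hg', ?_⟩
    rw [map_add, add_sub_add_comm]
    exact Submodule.add_mem _ hf hg
  | smul a f hmem hf =>
    clear hmem
    rw [smul_eq_mul]
    induction a using MvPolynomial.induction_on generalizing f D with
    | C c =>
      obtain ⟨f', hf', hf⟩ := hf D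
      refine ⟨C c * f', J.mul_mem_left _ hf', ?_⟩
      rw [homogeneousComponent_C_mul, ← mul_sub, ← smul_eq_C_mul]
      exact Submodule.smul_mem _ _ hf
    | add p q hp hq =>
      obtain ⟨p', hp', hp⟩ := hp f hf D
      obtain ⟨q', hq', hq⟩ := hq f hf D
      refine ⟨p' + q', J.add_mem hp' hq', ?_⟩
      rw [add_mul, map_add, add_sub_add_comm]
      exact Submodule.add_mem _ hp hq
    | mul_X p i hp =>
      -- The variable is absorbed into `f`, whose approximation property is known in every degree
      -- and shifts by one.
      rw [mul_assoc, mul_comm (X i)]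
      refine hp (f * X i) (fun D => ?_) D
      cases D with
      | zero =>
        refine ⟨0, J.zero_mem, ?_⟩
        have : coeff 0 (f * X i) = 0 := by classical rw [coeff_mul_X', if_neg (by simp)]
        rw [homogeneousComponent_zero, this]
        simp
      | succ D =>
        obtain ⟨f', hf', hf⟩ := hf D
        refine ⟨f' * X i, J.mul_mem_right _ hf', ?_⟩
        rw [homogeneousComponent_succ_mul_X, ← sub_mul]
        exact mul_X_mem_lowDegree hf i

/-- Monomials that span modulo an ideal `⟨G⟩` with homogeneous generators span modulo every ideal
`J` that has the elements of `G` as top degree parts. -/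
theorem span_monomial_sup_eq_top {G : Set (MvPolynomial σ K)} {J : Ideal (MvPolynomial σ K)}
    (hG : ∀ g ∈ G, ∃ d, g.IsHomogeneous d ∧ ∃ g' ∈ J, g' - g ∈ lowDegree σ K d)
    {B : Set (σ →₀ ℕ)}
    (hB : restrictSupport K B ⊔ (Ideal.span G).restrictScalars K = ⊤) :
    restrictSupport K B ⊔ J.restrictScalars K = ⊤ := by
  have key : ∀ D, lowDegree σ K D ≤ restrictSupport K B ⊔ J.restrictScalars K := by
    intro D
    induction D with
    | zero =>
      intro p hp
      have : p = 0 := by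
        ext e
        by_contra he
        exact absurd (mem_lowDegree.mp hp e he) (Nat.not_lt_zero _)
      rw [this]
      exact Submodule.zero_mem _
    | succ D ih =>
      intro p hp
      obtain ⟨s, hs, f, hf, rfl⟩ := Submodule.mem_sup.mp (hB ▸ Submodule.mem_top (x := p))
      obtain ⟨f', hf', hlow⟩ := exists_mem_sub_homogeneousComponent_mem_lowDegree hG hf D
      -- A span of monomials is closed under homogeneous components, so only the component of `f`
      -- has to be traded, for `f'` modulo lower degree.
      have hsD : homogeneousComponent D s ∈ restrictSupport K B := by
        rw [mem_restrictSupport_iff] at hs ⊢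
        intro e he
        refine hs (mem_support_iff.mpr fun h => ?_)
        have he := mem_support_iff.mp he
        rw [coeff_homogeneousComponent, h, ite_self] at he
        exact he rfl
      have hp' := ih (sub_homogeneousComponent_mem_lowDegree hp)
      have h1 := Submodule.add_mem _ hp' (Submodule.mem_sup_left hsD)
      have h2 := Submodule.add_mem _ h1 (Submodule.mem_sup_right (x := f') hf')
      have h3 := Submodule.sub_mem _ h2 (ih hlow)
      rw [map_add] at h3
      convert h3 using 1
      ring
  refine eq_top_iff.mpr fun p _ => key (p.totalDegree + 1) (mem_lowDegree.mpr fun e he => ?_)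
  have := le_totalDegree (mem_support_iff.mpr he)
  rw [Finsupp.degree_apply]
  exact Nat.lt_succ_of_le this

/-- The ideal of the polynomials that vanish on a family of points. -/
noncomputable def vanishingIdealOf {ι : Type*} (y : ι → σ → K) : Ideal (MvPolynomial σ K) :=
  RingHom.ker (RingHom.pi fun i => eval (y i))

theorem mem_vanishingIdealOf {ι : Type*} {y : ι → σ → K} {p : MvPolynomial σ K} :
    p ∈ vanishingIdealOf y ↔ ∀ i, eval (y i) p = 0 := by
  rw [vanishingIdealOf, RingHom.mem_ker, funext_iff]
  rfl

theorem exists_eval_eq_ite {ι : Type*} [Fintype ι] [DecidableEq ι] {y : ι → σ → K}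
    (hy : Function.Injective y) (i : ι) :
    ∃ p : MvPolynomial σ K, ∀ j, eval (y j) p = if j = i then 1 else 0 := by
  have hne : ∀ j : ι, ∃ p : MvPolynomial σ K, eval (y i) p = 1 ∧ (j ≠ i → eval (y j) p = 0) := by
    intro j
    by_cases hj : j = i
    · exact ⟨1, by simp, fun h => absurd hj h⟩
    · obtain ⟨l, hl⟩ := Function.ne_iff.mp (hy.ne hj)
      have hl' : y i l - y j l ≠ 0 := sub_ne_zero.mpr hl.symm
      refine ⟨C (y i l - y j l)⁻¹ * (X l - C (y j l)), ?_, fun _ => ?_⟩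
      · simp [hl']
      · simp
  choose p hp1 hp2 using hne
  refine ⟨∏ j, p j, fun j => ?_⟩
  rw [map_prod]
  split_ifs with h
  · subst h; exact Finset.prod_eq_one fun j' _ => hp1 j'
  · exact Finset.prod_eq_zero (Finset.mem_univ j) (hp2 j h)

/-- Evaluation at distinct points is onto by interpolation and kills the vanishing ideal, so the
images of the monomials span a space of dimension `Fintype.card ι`. -/
theorem card_le_card_of_span_monomial_sup_vanishingIdealOf {ι β : Type*} [Fintype ι] [Fintype β]
    {y : ι → σ → K} (hy : Function.Injective y) (E : β → σ →₀ ℕ)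
    (h : restrictSupport K (Set.range E) ⊔ (vanishingIdealOf y).restrictScalars K = ⊤) :
    Fintype.card ι ≤ Fintype.card β := by
  classical
  let ev : MvPolynomial σ K →ₗ[K] (ι → K) := LinearMap.pi fun i => (aeval (y i)).toLinearMap
  have hev : ∀ p i, ev p i = eval (y i) p := fun p i => by
    simp [ev]
  have hsurj : LinearMap.range ev = ⊤ := by
    refine LinearMap.range_eq_top.mpr fun v => ?_
    choose p hp using exists_eval_eq_ite hy
    refine ⟨∑ i, C (v i) * p i, funext fun j => ?_⟩
    rw [hev, map_sum]
    simp [hp]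
  have hker : ((vanishingIdealOf y).restrictScalars K).map ev = ⊥ := by
    rw [eq_bot_iff, Submodule.map_le_iff_le_comap]
    intro p hp
    rw [Submodule.mem_comap, Submodule.mem_bot]
    ext i
    rw [hev]
    exact mem_vanishingIdealOf.mp hp i
  have hspan : Submodule.span K (Set.range fun b => ev (monomial (E b) 1)) = ⊤ := by
    rw [← hsurj, LinearMap.range_eq_map, ← h, Submodule.map_sup, hker, sup_bot_eq,
      restrictSupport_eq_span, Submodule.map_span, ← Set.range_comp, ← Set.range_comp]
    rfl
  have := finrank_range_le_card (R := K) fun b => ev (monomial (E b) 1)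
  rwa [Set.finrank, hspan, finrank_top, Module.finrank_fintype_fun_eq_card] at this

end TopDegree

/-! ### The point set, the dimension bound and the spanning family. -/

section Points

variable {K : Type*} [Field K] {n k r : ℕ}

theorem isHomogeneous_hsymm (d : ℕ) : (hsymm (Fin n) K d).IsHomogeneous d := by
  have h := coeff_completeSeries_univ (F := K) (X : Fin n → MvPolynomial (Fin n) K) d
  rw [aeval_X_left_apply] at h
  rw [← h, coeff_completeSeries_X]
  refine IsHomogeneous.sum _ _ _ fun l hl => isHomogeneous_monomial _ ?_
  rw [Finsupp.degree_eq_sum]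
  exact (Finset.mem_finsuppAntidiag.mp hl).1

theorem isHomogeneous_esymm (d : ℕ) : (esymm (Fin n) K d).IsHomogeneous d := by
  refine IsHomogeneous.sum _ _ _ fun t ht => ?_
  have := IsHomogeneous.prod t (fun i => (X i : MvPolynomial (Fin n) K)) (fun _ => 1)
    fun i _ => isHomogeneous_X _ _
  rwa [Finset.sum_const, smul_eq_mul, mul_one, (Finset.mem_powersetCard.mp ht).2] at this

theorem sum_antidiagonal_sub_mem_lowDegree {σ : Type*} {q : ℕ → MvPolynomial σ K}
    (hq : ∀ a, (q a).IsHomogeneous a) {c : ℕ → K} (hc : c 0 = 1) (d : ℕ) :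
    ∑ p ∈ Finset.HasAntidiagonal.antidiagonal d, C (c p.2) * q p.1 - q d ∈ lowDegree σ K d := by
  have hmem : (d, 0) ∈ Finset.HasAntidiagonal.antidiagonal d := by simp
  rw [← Finset.add_sum_erase _ _ hmem, hc, C_1, one_mul, add_sub_cancel_left]
  refine Submodule.sum_mem _ fun p hp => ?_
  rw [Finset.mem_erase, Finset.HasAntidiagonal.mem_antidiagonal] at hp
  refine ((hq p.1).C_mul _).mem_lowDegree ?_
  by_contra h
  exact hp.1 (Prod.ext (by simp only; omega) (by simp only; omega))

/-- The point whose coordinates are the first `n` entries of `π`, labelled by `α`. -/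
def permPoint {A : Type*} (α : Fin (n + k) → A) (π : Equiv.Perm (Fin (n + k))) : Fin n → A :=
  fun i => α (π (Fin.castAdd k i))

/-- The set of the first `n` entries of `π`. -/
def firstEntries (π : Equiv.Perm (Fin (n + k))) : Finset (Fin (n + k)) :=
  Finset.univ.map ((Fin.castAddEmb k).trans π.toEmbedding)

theorem card_firstEntries (π : Equiv.Perm (Fin (n + k))) : (firstEntries π).card = n := by
  simp [firstEntries]

theorem completeSeries_permPoint (α : Fin (n + k) → K) (π : Equiv.Perm (Fin (n + k))) :
    completeSeries (permPoint α π) Finset.univ = completeSeries α (firstEntries π) := by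
  rw [completeSeries, completeSeries, firstEntries, Finset.prod_map]
  rfl

theorem elementarySeries_permPoint (α : Fin (n + k) → K) (π : Equiv.Perm (Fin (n + k))) :
    elementarySeries (permPoint α π) Finset.univ = elementarySeries α (firstEntries π) := by
  rw [elementarySeries, elementarySeries, firstEntries, Finset.prod_map]
  rfl

/-- At each point, the complete series of the coordinates times the elementary series of all labels
is the elementary series of the `k` unused labels, with no coefficient beyond `k`. -/
theorem exists_vanishing_sub_hsymm_mem_lowDegree (α : Fin (n + k) → K) {d : ℕ} (hd : k + 1 ≤ d) :
    ∃ g ∈ vanishingIdealOf fun π : schubertIndex n k r => permPoint α π.1,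
      g - hsymm (Fin n) K d ∈ lowDegree (Fin n) K d := by
  refine ⟨_, ?_, sum_antidiagonal_sub_mem_lowDegree isHomogeneous_hsymm
    (c := fun b => PowerSeries.coeff b (elementarySeries α Finset.univ)) ?_ d⟩
  · rw [mem_vanishingIdealOf]
    intro π
    have h : PowerSeries.coeff d (completeSeries (permPoint α π.1) Finset.univ *
        elementarySeries α Finset.univ) = 0 := by
      rw [completeSeries_permPoint, ← elementarySeries_sdiff _ (Finset.subset_univ _)]
      apply coeff_elementarySeries_eq_zero
      rw [Finset.card_univ_sdiff, card_firstEntries, Fintype.card_fin]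
      omega
    rw [← h, PowerSeries.coeff_mul, map_sum]
    refine Finset.sum_congr rfl fun p _ => ?_
    rw [coeff_completeSeries_univ (F := K), map_mul, eval_C, mul_comm]
    rfl
  · rw [coeff_elementarySeries]; simp

/-- The labels of the `r` smallest values occur in every point. Dividing them out of the elementary
series of the coordinates leaves a polynomial of degree at most `n - r`, which is less than `d`. -/
theorem exists_vanishing_sub_esymm_mem_lowDegree (hr : r ≤ n) (α : Fin (n + k) → K) {d : ℕ}
    (hd : n + 1 ≤ d + r) :
    ∃ g ∈ vanishingIdealOf fun π : schubertIndex n k r => permPoint α π.1,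
      g - esymm (Fin n) K d ∈ lowDegree (Fin n) K d := by
  set T : Finset (Fin (n + k)) := Finset.univ.filter fun v => (v : ℕ) < r with hT
  have hTcard : T.card = r := by
    rw [hT, Fin.card_filter_val_lt]; omega
  have hlow := sum_antidiagonal_sub_mem_lowDegree (K := K) (σ := Fin n)
    (q := fun a => C ((-1) ^ a) * esymm (Fin n) K a) (fun a => (isHomogeneous_esymm a).C_mul _)
    (c := fun b => PowerSeries.coeff b (completeSeries α T))
    (by simp [coeff_completeSeries]) d
  have hsign : (C ((-1) ^ d) : MvPolynomial (Fin n) K) * (C ((-1) ^ d) * esymm (Fin n) K d) =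
      esymm (Fin n) K d := by
    rw [← mul_assoc, ← C_mul, ← mul_pow]; simp
  have hlow' := Submodule.smul_mem _ ((-1) ^ d : K) hlow
  rw [smul_eq_C_mul, mul_sub, hsign] at hlow'
  refine ⟨_, Ideal.mul_mem_left _ _ ?_, hlow'⟩
  rw [mem_vanishingIdealOf]
  intro π
  have hTS : T ⊆ firstEntries π.1 := by
    intro v hv
    obtain ⟨i, hi, hiv⟩ := π.2.2 v (by simpa [hT] using hv)
    exact Finset.mem_map.mpr ⟨⟨i, hi⟩, Finset.mem_univ _, hiv⟩
  have h : PowerSeries.coeff d (elementarySeries (permPoint α π.1) Finset.univ *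
      completeSeries α T) = 0 := by
    rw [elementarySeries_permPoint, mul_comm, ← elementarySeries_sdiff _ hTS]
    apply coeff_elementarySeries_eq_zero
    rw [Finset.card_sdiff_of_subset hTS, card_firstEntries, hTcard]
    omega
  rw [← h, PowerSeries.coeff_mul, map_sum]
  refine Finset.sum_congr rfl fun p _ => ?_
  rw [coeff_elementarySeries_univ (F := K), map_mul, map_mul, eval_C, eval_C,
    mul_comm]
  rfl

/-- The entries after position `n` increase, so they are determined by the set of values that the
first `n` entries leave over. -/
theorem permPoint_injective {A : Type*} {α : Fin (n + k) → A} (hα : Function.Injective α) :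
    Function.Injective fun π : schubertIndex n k r => permPoint α π.1 := by
  rintro ⟨π, hπ⟩ ⟨τ, hτ⟩ h
  have hfirst : ∀ i : Fin n, π (Fin.castAdd k i) = τ (Fin.castAdd k i) := fun i =>
    hα (congrFun h i)
  have hmono : ∀ ρ ∈ schubertIndex n k r, StrictMono fun l : Fin k => ρ (Fin.natAdd n l) :=
    fun ρ hρ a b hab => apply_lt_apply_of_mem_schubertIndex hρ (by simp) (by simpa using hab)
  have hrange : ∀ ρ : Equiv.Perm (Fin (n + k)), (Set.range fun l : Fin k => ρ (Fin.natAdd n l)) =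
      {v | ∀ i : Fin n, ρ (Fin.castAdd k i) ≠ v} := by
    intro ρ
    ext v
    obtain ⟨j, rfl⟩ := ρ.surjective v
    simp only [Set.mem_range, Set.mem_ofPred_eq, Ne, EmbeddingLike.apply_eq_iff_eq]
    refine Fin.addCases (fun i => ?_) (fun l => ?_) j
    · refine iff_of_false ?_ fun h => h i rfl
      rintro ⟨l, hl⟩
      have := congrArg Fin.val hl
      simp at this
      omega
    · refine iff_of_true ⟨l, rfl⟩ fun i hi => ?_
      have := congrArg Fin.val hi
      simp at this
      omega
  have hlast := ((hmono π hπ).range_inj (hmono τ hτ)).mp (by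
    rw [hrange, hrange]; simp only [hfirst])
  refine Subtype.ext (Equiv.ext fun j => ?_)
  exact Fin.addCases hfirst (fun l => congrFun hlast l) j

noncomputable instance fintypeSchubertIndex : Fintype (schubertIndex n k r) := Fintype.ofFinite _

/-- Monomials that span the quotient number at least as many as the permutations in the index set. -/
theorem card_schubertIndex_le_of_infinite [Infinite K] (hr : r ≤ n) {β : Type*} [Fintype β]
    (E : β → Fin n →₀ ℕ)
    (hE : restrictSupport K (Set.range E) ⊔ (idealI K n k r).restrictScalars K = ⊤) :
    Fintype.card (schubertIndex n k r) ≤ Fintype.card β := by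
  obtain ⟨α⟩ : Nonempty (Fin (n + k) ↪ K) :=
    ⟨(Fin.valEmbedding).trans (Infinite.natEmbedding K)⟩
  refine card_le_card_of_span_monomial_sup_vanishingIdealOf
    (permPoint_injective (r := r) α.injective) E (span_monomial_sup_eq_top ?_ hE)
  rintro g (⟨d, h1, -, rfl⟩ | ⟨d, h1, -, rfl⟩)
  · exact ⟨d, isHomogeneous_hsymm d, exists_vanishing_sub_hsymm_mem_lowDegree α h1⟩
  · exact ⟨d, isHomogeneous_esymm d, exists_vanishing_sub_esymm_mem_lowDegree hr α h1⟩

theorem map_mem_idealI {F : Type*} [Field F] [Algebra F K] {f : MvPolynomial (Fin n) F}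
    (hf : f ∈ idealI F n k r) : map (algebraMap F K) f ∈ idealI K n k r := by
  suffices idealI F n k r ≤ (idealI K n k r).comap (map (algebraMap F K)) from this hf
  refine Ideal.span_le.mpr ?_
  rintro g (⟨d, h1, h2, rfl⟩ | ⟨d, h1, h2, rfl⟩)
  · rw [SetLike.mem_coe, Ideal.mem_comap, map_hsymm]
    exact hsymm_mem_idealI h1 h2
  · rw [SetLike.mem_coe, Ideal.mem_comap, map_esymm]
    exact esymm_mem_idealI h1 h2

/-- Spanning by monomials modulo the ideal passes to an extension field, and the algebraic closure
is infinite. -/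
theorem card_schubertIndex_le {F : Type*} [Field F] (hr : r ≤ n) {β : Type*} [Fintype β]
    (E : β → Fin n →₀ ℕ)
    (hE : restrictSupport F (Set.range E) ⊔ (idealI F n k r).restrictScalars F = ⊤) :
    Fintype.card (schubertIndex n k r) ≤ Fintype.card β := by
  let K := AlgebraicClosure F
  have : Infinite K := IsAlgClosed.instInfinite
  refine card_schubertIndex_le_of_infinite (K := K) hr E (eq_top_iff.mpr fun p _ => ?_)
  rw [p.as_sum]
  refine Submodule.sum_mem _ fun e _ => ?_
  obtain ⟨s, hs, f, hf, hsf⟩ := Submodule.mem_sup.mp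
    (hE ▸ Submodule.mem_top (x := (monomial e 1 : MvPolynomial (Fin n) F)))
  have h1 : monomial e (coeff e p) =
      coeff e p • (map (algebraMap F K) s + map (algebraMap F K) f) := by
    rw [← map_add, hsf, map_monomial, map_one, smul_monomial, smul_eq_mul, mul_one]
  rw [h1]
  refine Submodule.smul_mem _ _ (Submodule.add_mem _ (Submodule.mem_sup_left ?_)
    (Submodule.mem_sup_right (map_mem_idealI hf)))
  rw [mem_restrictSupport_iff] at hs ⊢
  exact fun e he => hs (support_map_subset _ _ he)

/-- The bound is applied to a basis of the quotient chosen among the images of monomials. -/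
theorem card_schubertIndex_le_finrank {F : Type*} [Field F] (hr : r ≤ n)
    [FiniteDimensional F (quotientR F n k r)] :
    Fintype.card (schubertIndex n k r) ≤ Module.finrank F (quotientR F n k r) := by
  let mk : MvPolynomial (Fin n) F →ₗ[F] quotientR F n k r :=
    (Ideal.Quotient.mkₐ F (idealI F n k r)).toLinearMap
  have hmk : ∀ p, mk p = Ideal.Quotient.mk (idealI F n k r) p := fun _ => rfl
  obtain ⟨β, a, -, hspan, hind⟩ :=
    exists_linearIndependent' F fun e : Fin n →₀ ℕ => mk (monomial e 1)
  have hsurj : LinearMap.range mk = ⊤ := LinearMap.range_eq_top.mpr Ideal.Quotient.mk_surjective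
  have hmap : ∀ {γ : Type} (E : γ → Fin n →₀ ℕ),
      Submodule.span F (Set.range fun e => mk (monomial (E e) 1)) =
        (restrictSupport F (Set.range E)).map mk := by
    intro γ E
    rw [restrictSupport_eq_span, Submodule.map_span, ← Set.range_comp, ← Set.range_comp]
    rfl
  have htop : (restrictSupport F (Set.range a)).map mk = ⊤ := by
    rw [← hmap, ← hsurj, LinearMap.range_eq_map]
    refine hspan.trans ((hmap id).trans ?_)
    rw [Set.range_id, restrictSupport_univ]
  have := hind.finite
  have := Fintype.ofFinite β
  refine le_trans (card_schubertIndex_le (F := F) hr a (eq_top_iff.mpr fun p _ => ?_))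
    hind.fintype_card_le_finrank
  obtain ⟨s, hs, hsp⟩ := Submodule.mem_map.mp (htop ▸ Submodule.mem_top (x := mk p))
  rw [hmk, hmk, Ideal.Quotient.eq, ← neg_mem_iff, neg_sub] at hsp
  exact Submodule.mem_sup.mpr ⟨s, hs, p - s, hsp, by ring⟩

theorem span_reversedSchubert_eq_top (F : Type*) [Field F] (hr : r ≤ n) :
    Submodule.span F (Set.range (fun π : schubertIndex n k r =>
      (Ideal.Quotient.mk (idealI F n k r) (reversedSchubert F n k π) : quotientR F n k r))) = ⊤ := by
  let mk : MvPolynomial (Fin n) F →ₗ[F] quotientR F n k r :=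
    (Ideal.Quotient.mkₐ F (idealI F n k r)).toLinearMap
  set V := Submodule.span F (Set.range (fun π : schubertIndex n k r =>
    (Ideal.Quotient.mk (idealI F n k r) (reversedSchubert F n k π) : quotientR F n k r)))
  have hV : V.comap mk = ⊤ := by
    refine submodule_eq_top_of_forall_exists_degree MonomialOrder.lex _ fun e => ?_
    by_cases he : e ∈ goodExponents n k r
    · obtain ⟨π, hπ, rfl⟩ := exists_reversedCode_eq hr he
      exact ⟨reversedSchubert F n k π, Submodule.subset_span ⟨⟨π, hπ⟩, rfl⟩, degree_reversedSchubert hπ⟩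
    · obtain ⟨f, hf, h⟩ := exists_mem_idealI_of_not_mem_goodExponents (F := F) hr he
      refine ⟨f, ?_, h⟩
      have : mk f = 0 := Ideal.Quotient.eq_zero_iff_mem.mpr hf
      rw [Submodule.mem_comap, this]
      exact V.zero_mem
  refine eq_top_iff.mpr fun x _ => ?_
  obtain ⟨p, rfl⟩ := Ideal.Quotient.mk_surjective x
  exact (hV ▸ Submodule.mem_top : p ∈ V.comap mk)

end Points

theorem mainTheorem10 (F : Type*) [Field F] (n k r : ℕ) (hr : r ≤ n) :
    (fun π => MonomialOrder.lex.leadingTerm (reversedSchubert F n k π)) '' schubertIndex n k r =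
      goodMonomials F n k r ∧
    LinearIndependent F (fun π : schubertIndex n k r =>
      (Ideal.Quotient.mk (idealI F n k r) (reversedSchubert F n k π) : quotientR F n k r)) ∧
    Submodule.span F (Set.range (fun π : schubertIndex n k r =>
      (Ideal.Quotient.mk (idealI F n k r) (reversedSchubert F n k π) : quotientR F n k r))) = ⊤ := by
  have hspan := span_reversedSchubert_eq_top (k := k) F hr
  refine ⟨?_, ?_, hspan⟩
  · rw [goodMonomials_eq, ← image_reversedCode hr, Set.image_image]
    refine Set.image_congr fun π hπ => ?_
    obtain ⟨h1, h2⟩ := degree_reversedSchubert (R := F) hπ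
    rw [MonomialOrder.leadingTerm, h1, h2.leadingCoeff_eq_one]
  · have : FiniteDimensional F (quotientR F n k r) :=
      ⟨⟨(Set.finite_range _).toFinset, by simpa using hspan⟩⟩
    exact linearIndependent_of_top_le_span_of_card_le_finrank hspan.ge
      (card_schubertIndex_le_finrank hr)
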